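/- Let $(M,g)$ be a compact, connected smooth Riemannian manifold (without boundary), let $\lambda<0$ be a real number and let $\varphi:M\to\mathbb{C}$ be a smooth, non-constant function. Write $\tau$ for the Laplace--Beltrami operator, given in local coordinates by $$\tau(\varphi)=\sum_{i,j}\frac{1}{\sqrt{|g|}}\,\partial_j\bigl(g^{ij}\sqrt{|g|}\,\partial_i\varphi\bigr),$$ and $\kappa(\varphi,\varphi)=g(\nabla\varphi,\nabla\varphi)=\sum_{i,j}g^{ij}\,\partial_i\varphi\,\partial_j\varphi$, where $g$ is extended complex bilinearly. The function $\varphi$ is called a $(\lambda,\lambda)$-eigenfunction if $\tau(\varphi)=\lambda\varphi$ and $\kappa(\varphi,\varphi)=\lambda\varphi^2$ on $M$. Let $S^1\subset\mathbb{C}$ be the unit circle and let $dt^2$ be its standard metric, for which $t\mapsto e^{it}$ has unit speed. The following are equivalent: 1. $\varphi$ is a $(\lambda,\lambda)$-eigenfunction. 2. For every $x_0\in M$ one has $\varphi(x_0)\neq0$, the map $\pi(x)=\varphi(x)/|\varphi(x_0)|$ takes values in $S^1$, and $\pi:(M,g)\to\bigl(S^1,\tfrac{1}{|\lambda|}dt^2\bigr)$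 is a harmonic map and a Riemannian submersion onto $S^1$; that is, $\pi$ is smooth and surjective, its tension field vanishes, each differential $d\pi_x$ is surjective, and $d\pi_x$ is isometric on $(\ker d\pi_x)^\perp$. -/

import Mathlib

open scoped Manifold ContDiff

noncomputable section

namespace LLEigen

/-- Smooth Riemannian metrics on an `m`-dimensional smooth manifold without boundary. -/
abbrev Metric (m : ℕ) (M : Type*) [TopologicalSpace M] [ChartedSpace (EuclideanSpace ℝ (Fin m)) M]
    [IsManifold (𝓡 m) ∞ M] :=
  Bundle.ContMDiffRiemannianMetric (𝓡 m) ∞ (EuclideanSpace ℝ (Fin m))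
    (fun x : M => TangentSpace (𝓡 m) x)

section Coordinates

variable {m : ℕ}

/-- The `i`-th partial derivative of a function on `ℝ^m`. -/
def pd {F : Type*} [NormedAddCommGroup F] [NormedSpace ℝ F] (i : Fin m)
    (f : EuclideanSpace ℝ (Fin m) → F) (p : EuclideanSpace ℝ (Fin m)) : F :=
  fderiv ℝ f p (EuclideanSpace.single i 1)

variable {M : Type*} [TopologicalSpace M] [ChartedSpace (EuclideanSpace ℝ (Fin m)) M]

/-- The `i`-th coordinate vector of the chart `e`, at the point with coordinates `p`. -/
def coordVec (e : OpenPartialHomeomorph M (EuclideanSpace ℝ (Fin m))) (i : Fin m)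
    (p : EuclideanSpace ℝ (Fin m)) : TangentSpace (𝓡 m) (e.symm p) :=
  mfderiv (𝓡 m) (𝓡 m) e.symm p (EuclideanSpace.single i (1 : ℝ) : EuclideanSpace ℝ (Fin m))

variable [IsManifold (𝓡 m) ∞ M]

/-- The matrix `(g_ij)` of the metric in the chart `e`, at the point with coordinates `p`. -/
def gram (g : Metric m M) (e : OpenPartialHomeomorph M (EuclideanSpace ℝ (Fin m)))
    (p : EuclideanSpace ℝ (Fin m)) : Matrix (Fin m) (Fin m) ℝ :=
  Matrix.of fun i j => g.inner (e.symm p) (coordVec e i p) (coordVec e j p)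

/-- The Laplace-Beltrami operator `|g|^(-1/2) ∑ ∂_j (g^ij |g|^(1/2) ∂_i φ)` in the chart `e`,
at the point with coordinates `p`. -/
def coordLaplacian {F : Type*} [NormedAddCommGroup F] [NormedSpace ℝ F]
    (g : Metric m M) (e : OpenPartialHomeomorph M (EuclideanSpace ℝ (Fin m))) (φ : M → F)
    (p : EuclideanSpace ℝ (Fin m)) : F :=
  (1 / √(gram g e p).det) • ∑ i, ∑ j,
    pd j (fun q => ((gram g e q)⁻¹ i j * √(gram g e q).det) • pd i (φ ∘ e.symm) q) p

/-- The conformality operator `∑ g^ij ∂_i φ ∂_j ψ` in the chart `e`, at the point with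
coordinates `p`. -/
def coordKappa (g : Metric m M) (e : OpenPartialHomeomorph M (EuclideanSpace ℝ (Fin m)))
    (φ ψ : M → ℂ) (p : EuclideanSpace ℝ (Fin m)) : ℂ :=
  ∑ i, ∑ j, ((gram g e p)⁻¹ i j : ℂ) * pd i (φ ∘ e.symm) p * pd j (ψ ∘ e.symm) p

/-- The Christoffel symbol `Γ^γ_αβ` of the metric in the chart `e`, at the point with
coordinates `p`. -/
def christoffel (g : Metric m M) (e : OpenPartialHomeomorph M (EuclideanSpace ℝ (Fin m)))
    (γ α β : Fin m) (p : EuclideanSpace ℝ (Fin m)) : ℝ :=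
  (1 / 2) * ∑ δ, (gram g e p)⁻¹ γ δ *
    (pd α (fun q => gram g e q β δ) p + pd β (fun q => gram g e q α δ) p
      - pd δ (fun q => gram g e q α β) p)

/-- `f` is the image `τ(φ)` of `φ` under the Laplace-Beltrami operator. -/
def HasLaplacian (g : Metric m M) (φ f : M → ℂ) : Prop :=
  ∀ e ∈ IsManifold.maximalAtlas (𝓡 m) ∞ M, ∀ x ∈ e.source, coordLaplacian g e φ (e x) = f x

/-- `f` is the function `κ(φ, ψ) = g(∇φ, ∇ψ)`, where `g` is extended complex bilinearly. -/
def HasKappa (g : Metric m M) (φ ψ f : M → ℂ) : Prop :=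
  ∀ e ∈ IsManifold.maximalAtlas (𝓡 m) ∞ M, ∀ x ∈ e.source, coordKappa g e φ ψ (e x) = f x

/-- `φ` is a `(lam, mu)`-eigenfunction: `τ(φ) = lam φ` and `κ(φ, φ) = mu φ²`. -/
structure IsEigenfunction (g : Metric m M) (lam mu : ℂ) (φ : M → ℂ) : Prop where
  contMDiff : ContMDiff (𝓡 m) 𝓘(ℝ, ℂ) ∞ φ
  laplacian : HasLaplacian g φ (fun x => lam * φ x)
  kappa : HasKappa g φ φ (fun x => mu * φ x ^ 2)

variable {n : ℕ} {N : Type*} [TopologicalSpace N] [ChartedSpace (EuclideanSpace ℝ (Fin n)) N]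
  [IsManifold (𝓡 n) ∞ N]

/-- The `γ`-th component of the tension field of `π : (M, g) → (N, h)` in the charts `e` of `M`
and `f` of `N`, at the point with coordinates `p`:
`τ(π)^γ = Δ_g π^γ + ∑ g^ij Γ^γ_αβ(π) ∂_i π^α ∂_j π^β`. -/
def coordTension (g : Metric m M) (h : Metric n N)
    (e : OpenPartialHomeomorph M (EuclideanSpace ℝ (Fin m)))
    (f : OpenPartialHomeomorph N (EuclideanSpace ℝ (Fin n))) (π : M → N) (γ : Fin n)
    (p : EuclideanSpace ℝ (Fin m)) : ℝ :=
  coordLaplacian g e (fun x => f (π x) γ) p +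
    ∑ i, ∑ j, ∑ α, ∑ β, (gram g e p)⁻¹ i j * christoffel h f γ α β (f (π (e.symm p))) *
      pd i (fun q => f (π (e.symm q)) α) p * pd j (fun q => f (π (e.symm q)) β) p

/-- `π : (M, g) → (N, h)` is a harmonic map: it is smooth and its tension field vanishes. -/
structure IsHarmonicMap (g : Metric m M) (h : Metric n N) (π : M → N) : Prop where
  contMDiff : ContMDiff (𝓡 m) (𝓡 n) ∞ π
  tension_eq_zero : ∀ e ∈ IsManifold.maximalAtlas (𝓡 m) ∞ M,
    ∀ f ∈ IsManifold.maximalAtlas (𝓡 n) ∞ N, ∀ x ∈ e.source, π x ∈ f.source →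
      ∀ γ, coordTension g h e f π γ (e x) = 0

/-- `π : (M, g) → (N, h)` is a Riemannian submersion of `M` onto `N`: it is smooth and onto, its
differentials are onto, and they are isometric on the orthogonal complements of their kernels. -/
structure IsRiemannianSubmersion (g : Metric m M) (h : Metric n N) (π : M → N) : Prop where
  contMDiff : ContMDiff (𝓡 m) (𝓡 n) ∞ π
  surjective : Function.Surjective π
  surjective_mfderiv : ∀ x, Function.Surjective (mfderiv (𝓡 m) (𝓡 n) π x)
  isometric : ∀ (x : M) (v w : TangentSpace (𝓡 m) x),
    (∀ u, mfderiv (𝓡 m) (𝓡 n) π x u = 0 → g.inner x v u = 0) →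
    (∀ u, mfderiv (𝓡 m) (𝓡 n) π x u = 0 → g.inner x w u = 0) →
    h.inner (π x) (mfderiv (𝓡 m) (𝓡 n) π x v) (mfderiv (𝓡 m) (𝓡 n) π x w) = g.inner x v w

end Coordinates

section CircleMetric

/-- The differential at `z` of the inclusion of the unit circle in `ℂ`. -/
def circleIncl (z : Circle) : TangentSpace (𝓡 1) z →L[ℝ] ℂ :=
  mfderiv (𝓡 1) 𝓘(ℝ, ℂ) (fun w : Circle => (w : ℂ)) z

/-- The bilinear form of the metric `c dt²` on the circle, where `dt²` is induced from `ℂ` (so that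
`t ↦ exp (i t)` has unit speed for `dt²`). -/
def circleForm (c : ℝ) (z : Circle) :
    TangentSpace (𝓡 1) z →L[ℝ] TangentSpace (𝓡 1) z →L[ℝ] ℝ :=
  let L : EuclideanSpace ℝ (Fin 1) →L[ℝ] ℂ := circleIncl z
  (c • (innerSL ℝ : ℂ →L[ℝ] ℂ →L[ℝ] ℝ).bilinearComp L L :
    EuclideanSpace ℝ (Fin 1) →L[ℝ] EuclideanSpace ℝ (Fin 1) →L[ℝ] ℝ)

theorem circleForm_apply (c : ℝ) (z : Circle) (v w : TangentSpace (𝓡 1) z) :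
    circleForm c z v w = c * inner ℝ (circleIncl z v) (circleIncl z w) :=
  rfl

theorem circleIncl_injective (z : Circle) : Function.Injective (circleIncl z) :=
  haveI : Fact (Module.finrank ℝ ℂ = 1 + 1) := finrank_real_complex_fact'
  injective_mvfderiv_subtypeVal_sphere (E := ℂ) (n := 1) z

theorem contMDiff_circle_coe : ContMDiff (𝓡 1) 𝓘(ℝ, ℂ) ∞ (fun w : Circle => (w : ℂ)) :=
  haveI : Fact (Module.finrank ℝ ℂ = 1 + 1) := finrank_real_complex_fact'
  contMDiff_coe_sphere (E := ℂ) (n := 1)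

theorem circleForm_pos {c : ℝ} (hc : 0 < c) (z : Circle) (v : TangentSpace (𝓡 1) z)
    (hv : v ≠ 0) : 0 < circleForm c z v v := by
  rw [circleForm_apply]
  refine mul_pos hc (real_inner_self_pos.2 fun h => hv ?_)
  exact circleIncl_injective z (h.trans (map_zero _).symm)

theorem circleForm_bounded {c : ℝ} (hc : 0 < c) (z : Circle) :
    Bornology.IsVonNBounded ℝ {v : TangentSpace (𝓡 1) z | circleForm c z v v < 1} := by
  let L : EuclideanSpace ℝ (Fin 1) →L[ℝ] ℂ := circleIncl z
  obtain ⟨K, hK, hL⟩ := L.toLinearMap.exists_antilipschitzWith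
    (LinearMap.ker_eq_bot.2 (circleIncl_injective z))
  change Bornology.IsVonNBounded ℝ {v : EuclideanSpace ℝ (Fin 1) | c * inner ℝ (L v) (L v) < 1}
  refine (NormedSpace.isVonNBounded_ball ℝ (EuclideanSpace ℝ (Fin 1)) (K * √(1 / c))).subset ?_
  intro v hv
  have hv' : c * inner ℝ (L v) (L v) < 1 := hv
  rw [real_inner_self_eq_norm_sq] at hv'
  have h1 : ‖L v‖ < √(1 / c) := by
    apply Real.lt_sqrt_of_sq_lt
    rw [lt_div_iff₀ hc]
    linarith
  have h2 : ‖v‖ ≤ K * ‖L v‖ := by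
    simpa using hL.le_mul_dist v 0
  rw [mem_ball_zero_iff]
  exact h2.trans_lt (mul_lt_mul_of_pos_left h1 (by exact_mod_cast hK))

theorem circleForm_contMDiff (c : ℝ) :
    ContMDiff (𝓡 1) ((𝓡 1).prod
      𝓘(ℝ, EuclideanSpace ℝ (Fin 1) →L[ℝ] EuclideanSpace ℝ (Fin 1) →L[ℝ] ℝ)) ∞
      (fun z : Circle => Bundle.TotalSpace.mk'
        (EuclideanSpace ℝ (Fin 1) →L[ℝ] EuclideanSpace ℝ (Fin 1) →L[ℝ] ℝ) z
        (circleForm c z : TangentSpace (𝓡 1) z →L[ℝ] TangentSpace (𝓡 1) z →L[ℝ] ℝ)) := by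
  intro z₀
  rw [Bundle.contMDiffAt_section]
  have hA := (contMDiff_circle_coe z₀).mfderiv_const (m := ∞) le_rfl
  have hB : ContDiff ℝ ∞ (fun T : EuclideanSpace ℝ (Fin 1) →L[ℝ] ℂ =>
      c • (innerSL ℝ : ℂ →L[ℝ] ℂ →L[ℝ] ℝ).bilinearComp T T) := by
    refine contDiff_clm_apply_iff.2 fun v => contDiff_clm_apply_iff.2 fun w => ?_
    have h : ContDiff ℝ ∞ (fun T : EuclideanSpace ℝ (Fin 1) →L[ℝ] ℂ =>
        c * inner ℝ (T v) (T w)) :=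
      contDiff_const.mul (ContDiff.inner ℝ (by fun_prop) (by fun_prop))
    exact h
  refine (hB.contMDiff.contMDiffAt.comp z₀ hA).congr_of_eventuallyEq ?_
  filter_upwards [(chartAt (EuclideanSpace ℝ (Fin 1)) z₀).open_source.mem_nhds
    (mem_chart_source _ z₀)] with z hz
  ext v w
  have hz' : z ∈ (trivializationAt (EuclideanSpace ℝ (Fin 1) →L[ℝ] ℝ)
      (fun x : Circle => TangentSpace (𝓡 1) x →L[ℝ] Bundle.Trivial Circle ℝ x) z₀).baseSet := by
    rw [hom_trivializationAt_baseSet]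
    exact ⟨hz, Set.mem_univ _⟩
  have key : ∀ u : EuclideanSpace ℝ (Fin 1),
      (inTangentCoordinates (𝓡 1) 𝓘(ℝ, ℂ) id (fun w : Circle => (w : ℂ))
        (mfderiv (𝓡 1) 𝓘(ℝ, ℂ) fun w : Circle => (w : ℂ)) z₀ z) u =
      circleIncl z ((trivializationAt (EuclideanSpace ℝ (Fin 1))
        (fun x : Circle => TangentSpace (𝓡 1) x) z₀).symmL ℝ z u) := by
    intro u
    simp [ContinuousLinearMap.inCoordinates, inTangentCoordinates]
    rfl
  refine Eq.trans ?_ (congrArg₂ (fun a b : ℂ => c * inner ℝ a b) (key v) (key w)).symm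
  change _ = circleForm c z _ _
  rw [hom_trivializationAt_apply]
  simp only [ContinuousLinearMap.inCoordinates, ContinuousLinearMap.comp_apply]
  rw [Bundle.Trivialization.continuousLinearMapAt_apply,
    Bundle.Trivialization.coe_linearMapAt_of_mem _ hz']
  beta_reduce
  rw [hom_trivializationAt_apply]
  simp [ContinuousLinearMap.inCoordinates]

/-- The Riemannian metric `c dt²` on the unit circle. -/
def circleMetric (c : ℝ) (hc : 0 < c) : Metric 1 Circle where
  inner := circleForm c
  symm z v w := by rw [circleForm_apply, circleForm_apply, real_inner_comm]
  pos := circleForm_pos hc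
  isVonNBounded := circleForm_bounded hc
  contMDiff := circleForm_contMDiff c

end CircleMetric

end LLEigen

end

/-! Locally a circle-valued map is `π = exp (iθ)`, and the chain rule gives `τ(π) = (i τ(θ) - |∇θ|²)
π` and `κ(π, π) = -|∇θ|² π²`. So `κ(π, π) = λ π²` says `|∇θ|² = -λ`. This means that `dπ` is onto
and isometric on the complement of its kernel for the metric `dt² / |λ|`. Once this holds, `τ(π) = λ
π` reduces to `τ(θ) = 0`, the harmonic map equation. For arbitrary charts of the circle these two
computations are `exists_coordLaplacian_circle_eq` and `submersion_iff_coordKappa`. Both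
eigenfunction equations are homogeneous in `φ`, so they pass between `φ` and `φ / |φ(x₀)|`.

It remains to show that an eigenfunction has constant modulus. For `φ = u + iv`, the κ-equation
prescribes `|∇u|² - |∇v|²` and `g(∇u, ∇v)`. Combined with `|u∇u + v∇v|² ≥ 0` this gives `|∇u|² +
|∇v|² ≥ -λ |φ|²`. Hence `τ(|φ|²) = 2λ |φ|² + 2 (|∇u|² + |∇v|²) ≥ 0` (`ellipticOp_normSq_nonneg`). A
subharmonic function on a compact connected manifold is constant by Hopf's strong maximum principle,
which is proved here in coordinates (`eventually_eq_of_isLocalMax`). The constant is nonzero because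
`φ` is not constant.

Surjectivity of `π` uses compactness: a map missing a point has a global continuous argument, and at
its maximum `dπ = 0`, contradicting `κ(π, π) ≠ 0`. -/

noncomputable section

namespace LLEigen

open Filter Topology

/-! ### Calculus of divergence-form second-order operators on `ℝ^m`. -/

section Elliptic

variable {m : ℕ} {F : Type*} [NormedAddCommGroup F] [NormedSpace ℝ F]

/-- The operator `ρ⁻¹ ∑ ∂_j (B_ij ρ ∂_i f)` on functions on `ℝ^m`. -/
def ellipticOp (B : EuclideanSpace ℝ (Fin m) → Matrix (Fin m) (Fin m) ℝ)
    (ρ : EuclideanSpace ℝ (Fin m) → ℝ) (f : EuclideanSpace ℝ (Fin m) → F)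
    (p : EuclideanSpace ℝ (Fin m)) : F :=
  (1 / ρ p) • ∑ i, ∑ j, pd j (fun q => (B q i j * ρ q) • pd i f q) p

/-- The bilinear form `∑ B_ij ∂_i f ∂_j h`. -/
def gradForm (B : EuclideanSpace ℝ (Fin m) → Matrix (Fin m) (Fin m) ℝ)
    (f h : EuclideanSpace ℝ (Fin m) → ℝ) (p : EuclideanSpace ℝ (Fin m)) : ℝ :=
  ∑ i, ∑ j, B p i j * pd i f p * pd j h p

/-- The coefficients of `ellipticOp` are `C^1` and elliptic at `p`. -/
structure IsEllipticAt (B : EuclideanSpace ℝ (Fin m) → Matrix (Fin m) (Fin m) ℝ)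
    (ρ : EuclideanSpace ℝ (Fin m) → ℝ) (p : EuclideanSpace ℝ (Fin m)) : Prop where
  posDef : (B p).PosDef
  pos : 0 < ρ p
  contDiffAt_coeff : ∀ i j, ContDiffAt ℝ 1 (fun q => B q i j) p
  contDiffAt_density : ContDiffAt ℝ 1 ρ p

theorem _root_.ContDiffAt.pd {f : EuclideanSpace ℝ (Fin m) → F} {p : EuclideanSpace ℝ (Fin m)}
    {k n : WithTop ℕ∞} (hf : ContDiffAt ℝ n f p)
    (h : k + 1 ≤ n) (i : Fin m) : ContDiffAt ℝ k (pd i f) p :=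
  (hf.fderiv_right h).clm_apply contDiffAt_const

theorem pd_congr {f f' : EuclideanSpace ℝ (Fin m) → F} {p : EuclideanSpace ℝ (Fin m)}
    (h : f =ᶠ[𝓝 p] f') (i : Fin m) :
    pd i f =ᶠ[𝓝 p] pd i f' := by
  filter_upwards [h.fderiv (𝕜 := ℝ)] with q hq
  simp only [pd, hq]

theorem pd_smul {c : EuclideanSpace ℝ (Fin m) → ℝ} {f : EuclideanSpace ℝ (Fin m) → F}
    {p : EuclideanSpace ℝ (Fin m)} (hc : DifferentiableAt ℝ c p)
    (hf : DifferentiableAt ℝ f p) (j : Fin m) :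
    pd j (fun q => c q • f q) p = c p • pd j f p + pd j c p • f p := by
  simp [pd, fderiv_fun_smul hc hf]

theorem pd_clm_comp {G : Type*} [NormedAddCommGroup G] [NormedSpace ℝ G] (L : F →L[ℝ] G)
    {f : EuclideanSpace ℝ (Fin m) → F} {p : EuclideanSpace ℝ (Fin m)}
    (hf : DifferentiableAt ℝ f p) (i : Fin m) :
    pd i (fun q => L (f q)) p = L (pd i f p) := by
  have h := (L.hasFDerivAt.comp p hf.hasFDerivAt).fderiv
  change fderiv ℝ (L ∘ f) p _ = _
  rw [h]; rfl

theorem pd_comp {y : EuclideanSpace ℝ (Fin m) → ℝ} {h : ℝ → F} {p : EuclideanSpace ℝ (Fin m)}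
    (hy : DifferentiableAt ℝ y p)
    (hh : DifferentiableAt ℝ h (y p)) (i : Fin m) :
    pd i (fun q => h (y q)) p = pd i y p • deriv h (y p) := by
  have := (hh.hasFDerivAt.comp p hy.hasFDerivAt).fderiv
  change fderiv ℝ (h ∘ y) p _ = _
  rw [this, ContinuousLinearMap.comp_apply, fderiv_eq_smul_deriv]
  rfl

theorem pd_pd_comp {y : EuclideanSpace ℝ (Fin m) → ℝ} {h : ℝ → F} {p : EuclideanSpace ℝ (Fin m)}
    (hy : ContDiffAt ℝ 2 y p)
    (hh : ContDiffAt ℝ 2 h (y p)) (i j : Fin m) :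
    pd j (pd i (fun q => h (y q))) p =
      pd j (pd i y) p • deriv h (y p) + (pd i y p * pd j y p) • deriv (deriv h) (y p) := by
  have hev : pd i (fun q => h (y q)) =ᶠ[𝓝 p] fun q => pd i y q • deriv h (y q) := by
    have h1 := hy.eventually (by simp)
    have h2 := hy.continuousAt.eventually (hh.eventually (by simp))
    filter_upwards [h1, h2] with q hq1 hq2
    exact pd_comp (hq1.differentiableAt (by norm_num)) (hq2.differentiableAt (by norm_num)) i
  have hd : DifferentiableAt ℝ (deriv h) (y p) :=
    ((hh.fderiv_right (m := 1) (by norm_num)).clm_apply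
      (contDiffAt_const (c := (1 : ℝ)))).differentiableAt (by norm_num)
  have hy1 : DifferentiableAt ℝ y p := hy.differentiableAt (by norm_num)
  rw [(pd_congr hev j).eq_of_nhds, pd_smul ((hy.pd (k := 1) (by norm_num) i).differentiableAt
    (by norm_num)) (hd.fun_comp' p hy1), pd_comp hy1 hd, smul_smul, add_comm]

/-- The first-order coefficients of `ellipticOp`. -/
def drift (B : EuclideanSpace ℝ (Fin m) → Matrix (Fin m) (Fin m) ℝ)
    (ρ : EuclideanSpace ℝ (Fin m) → ℝ) (i : Fin m) (p : EuclideanSpace ℝ (Fin m)) : ℝ :=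
  (1 / ρ p) * ∑ j, pd j (fun q => B q i j * ρ q) p

variable {B : EuclideanSpace ℝ (Fin m) → Matrix (Fin m) (Fin m) ℝ}
  {ρ : EuclideanSpace ℝ (Fin m) → ℝ} {p : EuclideanSpace ℝ (Fin m)}

theorem IsEllipticAt.contDiffAt_flux (hB : IsEllipticAt B ρ p) (i j : Fin m) :
    ContDiffAt ℝ 1 (fun q => B q i j * ρ q) p :=
  (hB.contDiffAt_coeff i j).mul hB.contDiffAt_density

theorem ellipticOp_eq (hB : IsEllipticAt B ρ p) {f : EuclideanSpace ℝ (Fin m) → F}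
    (hf : ContDiffAt ℝ 2 f p) :
    ellipticOp B ρ f p =
      ∑ i, ∑ j, B p i j • pd j (pd i f) p + ∑ i, drift B ρ i p • pd i f p := by
  have h : ∀ i j, pd j (fun q => (B q i j * ρ q) • pd i f q) p =
      (B p i j * ρ p) • pd j (pd i f) p + pd j (fun q => B q i j * ρ q) p • pd i f p :=
    fun i j => pd_smul ((hB.contDiffAt_flux i j).differentiableAt (by norm_num))
      ((hf.pd (k := 1) (by norm_num) i).differentiableAt (by norm_num)) j
  have hρ := hB.pos.ne'
  simp only [ellipticOp, h, drift, Finset.sum_add_distrib, smul_add, Finset.smul_sum, smul_smul,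
    Finset.mul_sum, Finset.sum_smul]
  congr 1
  refine Finset.sum_congr rfl fun i _ => Finset.sum_congr rfl fun j _ => ?_
  congr 1
  field_simp

theorem ellipticOp_congr {f f' : EuclideanSpace ℝ (Fin m) → F} (h : f =ᶠ[𝓝 p] f') :
    ellipticOp B ρ f p = ellipticOp B ρ f' p := by
  unfold ellipticOp
  congr 1
  refine Finset.sum_congr rfl fun i _ => Finset.sum_congr rfl fun j _ => ?_
  refine (pd_congr ?_ j).eq_of_nhds
  filter_upwards [pd_congr h i] with q hq
  rw [hq]

/-- The workhorse chain rule: it yields the formula for squares, Hopf's barrier, and the Laplacian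
of a circle-valued map. -/
theorem ellipticOp_comp (hB : IsEllipticAt B ρ p) {y : EuclideanSpace ℝ (Fin m) → ℝ} {h : ℝ → F}
    (hy : ContDiffAt ℝ 2 y p) (hh : ContDiffAt ℝ 2 h (y p)) :
    ellipticOp B ρ (fun q => h (y q)) p =
      ellipticOp B ρ y p • deriv h (y p) + gradForm B y y p • deriv (deriv h) (y p) := by
  have hcomp : ContDiffAt ℝ 2 (fun q => h (y q)) p := hh.comp p hy
  rw [ellipticOp_eq hB hcomp, ellipticOp_eq hB hy]
  simp only [pd_pd_comp hy hh, pd_comp (hy.differentiableAt (by norm_num))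
    (hh.differentiableAt (by norm_num)), gradForm, add_smul, Finset.sum_smul, smul_add,
    Finset.sum_add_distrib, smul_smul, smul_eq_mul, mul_assoc]
  abel

theorem ellipticOp_clm_comp (hB : IsEllipticAt B ρ p) {G : Type*} [NormedAddCommGroup G]
    [NormedSpace ℝ G] (L : F →L[ℝ] G) {f : EuclideanSpace ℝ (Fin m) → F} (hf : ContDiffAt ℝ 2 f p) :
    ellipticOp B ρ (fun q => L (f q)) p = L (ellipticOp B ρ f p) := by
  have hev (i : Fin m) : pd i (fun q => L (f q)) =ᶠ[𝓝 p] fun q => L (pd i f q) := by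
    filter_upwards [hf.eventually (by simp)] with q hq
    exact pd_clm_comp L (hq.differentiableAt (by norm_num)) i
  have h2 (i j : Fin m) : pd j (pd i (fun q => L (f q))) p = L (pd j (pd i f) p) := by
    rw [(pd_congr (hev i) j).eq_of_nhds]
    exact pd_clm_comp L ((hf.pd (k := 1) (by norm_num) i).differentiableAt (by norm_num)) j
  rw [ellipticOp_eq hB hf, ellipticOp_eq hB (L.contDiff.contDiffAt.fun_comp p hf)]
  simp only [h2, (hev _).eq_of_nhds, map_add, map_sum, map_smul]

theorem pd_add {f f' : EuclideanSpace ℝ (Fin m) → F} (hf : DifferentiableAt ℝ f p)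
    (hf' : DifferentiableAt ℝ f' p)
    (i : Fin m) : pd i (fun q => f q + f' q) p = pd i f p + pd i f' p := by
  simp [pd, fderiv_fun_add hf hf']

theorem ellipticOp_add (hB : IsEllipticAt B ρ p) {f f' : EuclideanSpace ℝ (Fin m) → F}
    (hf : ContDiffAt ℝ 2 f p)
    (hf' : ContDiffAt ℝ 2 f' p) :
    ellipticOp B ρ (fun q => f q + f' q) p = ellipticOp B ρ f p + ellipticOp B ρ f' p := by
  have hev (i : Fin m) : pd i (fun q => f q + f' q) =ᶠ[𝓝 p] fun q => pd i f q + pd i f' q := by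
    filter_upwards [hf.eventually (by simp), hf'.eventually (by simp)] with q hq hq'
    exact pd_add (hq.differentiableAt (by norm_num)) (hq'.differentiableAt (by norm_num)) i
  have h2 (i j : Fin m) :
      pd j (pd i (fun q => f q + f' q)) p = pd j (pd i f) p + pd j (pd i f') p := by
    rw [(pd_congr (hev i) j).eq_of_nhds]
    exact pd_add ((hf.pd (k := 1) (by norm_num) i).differentiableAt (by norm_num))
      ((hf'.pd (k := 1) (by norm_num) i).differentiableAt (by norm_num)) j
  rw [ellipticOp_eq hB hf, ellipticOp_eq hB hf', ellipticOp_eq hB (hf.add hf')]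
  simp only [h2, (hev _).eq_of_nhds, smul_add, Finset.sum_add_distrib]
  abel

theorem continuousAt_ellipticOp (hB : IsEllipticAt B ρ p) {f : EuclideanSpace ℝ (Fin m) → F}
    (hf : ContDiffAt ℝ 2 f p) : ContinuousAt (ellipticOp B ρ f) p := by
  refine (continuousAt_const.div hB.contDiffAt_density.continuousAt hB.pos.ne').smul ?_
  refine tendsto_finsetSum _ fun i _ => tendsto_finsetSum _ fun j _ => ?_
  exact (((hB.contDiffAt_flux i j).smul (hf.pd (k := 1) (by norm_num) i)).pd (k := 0)
    (by norm_num) j).continuousAt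

theorem continuousAt_gradForm (hB : IsEllipticAt B ρ p) {f h : EuclideanSpace ℝ (Fin m) → ℝ}
    (hf : ContDiffAt ℝ 1 f p) (hh : ContDiffAt ℝ 1 h p) : ContinuousAt (gradForm B f h) p := by
  refine tendsto_finsetSum _ fun i _ => tendsto_finsetSum _ fun j _ => ?_
  exact ((hB.contDiffAt_coeff i j).continuousAt.mul
    (hf.pd (k := 0) (by norm_num) i).continuousAt).mul
    (hh.pd (k := 0) (by norm_num) j).continuousAt

end Elliptic

/-! ### Hopf's strong maximum principle. -/

section MaximumPrinciple

variable {m : ℕ}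

variable {B : EuclideanSpace ℝ (Fin m) → Matrix (Fin m) (Fin m) ℝ}
  {ρ : EuclideanSpace ℝ (Fin m) → ℝ} {p : EuclideanSpace ℝ (Fin m)}

/-- A positive second derivative would make `t` a local minimum as well, so `h` would be locally
constant and its second derivative zero. -/
theorem deriv_deriv_nonpos_of_isLocalMax {h : ℝ → ℝ} {t : ℝ} (hh : ContinuousAt h t)
    (hmax : IsLocalMax h t) : deriv (deriv h) t ≤ 0 := by
  by_contra! hpos
  have hmin := isLocalMin_of_deriv_deriv_pos hpos hmax.deriv_eq_zero hh
  have hc : h =ᶠ[𝓝 t] fun _ => h t := by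
    filter_upwards [hmax, hmin] with s h1 h2 using le_antisymm h1 h2
  have : deriv (deriv h) t = 0 := by
    rw [hc.deriv.deriv_eq]; simp
  exact hpos.ne' this

theorem sum_pd_eq_fderiv {F : Type*} [NormedAddCommGroup F] [NormedSpace ℝ F]
    (f : EuclideanSpace ℝ (Fin m) → F)
    (q : EuclideanSpace ℝ (Fin m)) (v : Fin m → ℝ) : ∑ i, v i • pd i f q = fderiv ℝ f q
    (WithLp.toLp 2 v) := by
  have hv : (WithLp.toLp 2 v : EuclideanSpace ℝ (Fin m)) = ∑ i, v i • EuclideanSpace.single i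
    (1 : ℝ) := by
    ext k
    simp [Finset.sum_apply, Pi.single_apply]
  rw [hv, map_sum]
  simp [pd]

theorem hessian_nonpos_of_isLocalMax {w : EuclideanSpace ℝ (Fin m) → ℝ} (hw : ContDiffAt ℝ 2 w p)
    (hmax : IsLocalMax w p) (v : Fin m → ℝ) :
    ∑ i, ∑ j, v i * v j * pd j (pd i w) p ≤ 0 := by
  let l : ℝ → EuclideanSpace ℝ (Fin m) := fun t => p + t • WithLp.toLp 2 v
  have hl : ∀ t, HasDerivAt l (WithLp.toLp 2 v) t := fun t => by
    have h := ((hasDerivAt_id t).smul_const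
      (WithLp.toLp 2 v : EuclideanSpace ℝ (Fin m))).const_add p
    rw [one_smul] at h
    exact h
  have hl0 : l 0 = p := by simp [l]
  have hlc : Tendsto l (𝓝 0) (𝓝 p) := by simpa [hl0] using (hl 0).continuousAt.tendsto
  have hev : deriv (w ∘ l) =ᶠ[𝓝 0] fun t => ∑ i, v i • pd i w (l t) := by
    filter_upwards [hlc.eventually (hw.eventually (by simp))] with t ht
    rw [sum_pd_eq_fderiv]
    exact ((ht.differentiableAt (by norm_num)).hasFDerivAt.comp_hasDerivAt t (hl t)).deriv
  have hmax' : IsLocalMax (w ∘ l) 0 := by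
    have := hlc.eventually hmax
    simpa [IsLocalMax, IsMaxFilter, hl0] using this
  have hcont : ContinuousAt (w ∘ l) 0 :=
    ContinuousAt.comp (by rw [hl0]; exact hw.continuousAt) (hl 0).continuousAt
  have key := deriv_deriv_nonpos_of_isLocalMax hcont hmax'
  rw [hev.deriv_eq] at key
  have hd : ∀ i, HasDerivAt (fun t => v i • pd i w (l t)) (v i • ∑ j, v j • pd j (pd i w) p) 0 :=
    fun i => by
    rw [sum_pd_eq_fderiv]
    have h1 : DifferentiableAt ℝ (pd i w) (l 0) := by
      rw [hl0]; exact (hw.pd (k := 1) (by norm_num) i).differentiableAt (by norm_num)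
    have := (h1.hasFDerivAt.comp_hasDerivAt 0 (hl 0)).const_smul (v i)
    rw [hl0] at this
    exact this
  rw [(HasDerivAt.fun_sum fun i _ => hd i).deriv] at key
  simpa [Finset.mul_sum, mul_assoc] using key

theorem ellipticOp_nonpos_of_isLocalMax (hB : IsEllipticAt B ρ p) {w : EuclideanSpace ℝ (Fin m) → ℝ}
    (hw : ContDiffAt ℝ 2 w p) (hmax : IsLocalMax w p) : ellipticOp B ρ w p ≤ 0 := by
  have h0 : ∀ i, pd i w p = 0 := fun i => by simp [pd, hmax.fderiv_eq_zero]
  rw [ellipticOp_eq hB hw]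
  simp only [h0, smul_eq_mul, mul_zero, Finset.sum_const_zero, add_zero]
  -- Factoring the coefficient matrix as `CᵀC` turns the second-order part into a sum of Hessian
  -- values in the directions of the rows of `C`.
  obtain ⟨C, hC⟩ : ∃ C : Matrix (Fin m) (Fin m) ℝ, B p = C.conjTranspose * C := by
    open scoped MatrixOrder in
    exact CStarAlgebra.nonneg_iff_eq_star_mul_self.1 hB.posDef.posSemidef.nonneg
  have : ∑ i, ∑ j, B p i j * pd j (pd i w) p =
      ∑ k, ∑ i, ∑ j, C k i * C k j * pd j (pd i w) p := by
    rw [Finset.sum_comm]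
    simp only [hC, Matrix.mul_apply, Matrix.conjTranspose_apply, star_trivial, Finset.sum_mul]
    rw [Finset.sum_comm]
    calc _ = ∑ i, ∑ k, ∑ j, C k i * C k j * pd j (pd i w) p :=
          Finset.sum_congr rfl fun i _ => Finset.sum_comm
      _ = _ := Finset.sum_comm
  rw [this]
  exact Finset.sum_nonpos fun k _ => hessian_nonpos_of_isLocalMax hw hmax (C k)

theorem gradForm_eq_dotProduct (f h : EuclideanSpace ℝ (Fin m) → ℝ) :
    gradForm B f h p = (fun i => pd i f p) ⬝ᵥ (B p).mulVec (fun j => pd j h p) := by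
  simp only [gradForm, dotProduct, Matrix.mulVec, Finset.mul_sum]
  refine Finset.sum_congr rfl fun i _ => Finset.sum_congr rfl fun j _ => ?_
  ring

theorem gradForm_self_pos (hB : (B p).PosDef) {f : EuclideanSpace ℝ (Fin m) → ℝ}
    (hf : fderiv ℝ f p ≠ 0) : 0 < gradForm B f f p := by
  rw [gradForm_eq_dotProduct]
  refine hB.dotProduct_mulVec_pos fun h => hf ?_
  ext v
  have := sum_pd_eq_fderiv f p v.ofLp
  have h' : ∀ i, pd i f p = 0 := fun i => congrFun h i
  simpa [h'] using this.symm

/-- Hopf's barrier: `exp (-α |q - y|²)` is strictly subharmonic near a point other than `y` for a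
large `α`. -/
theorem exists_barrier {x y : EuclideanSpace ℝ (Fin m)} (hxy : x ≠ y)
    (hB : ∀ᶠ q in 𝓝 x, IsEllipticAt B ρ q) :
    ∃ α : ℝ, 0 < α ∧
      ∀ᶠ q in 𝓝 x, 0 < ellipticOp B ρ (fun q => Real.exp (-α * ‖q - y‖ ^ 2)) q := by
  let ψ : EuclideanSpace ℝ (Fin m) → ℝ := fun q => ‖q - y‖ ^ 2
  have hψ : ContDiff ℝ 2 ψ := (contDiff_id.sub contDiff_const).norm_sq ℝ
  have hψ' : fderiv ℝ ψ x ≠ 0 := by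
    intro h0
    have h1 : HasFDerivAt ψ _ x := ((hasFDerivAt_id x).sub_const y).norm_sq
    have h2 := congrArg (fun L : EuclideanSpace ℝ (Fin m) →L[ℝ] ℝ => L (x - y)) 
      (h1.fderiv.symm.trans h0)
    have h3 : (2 : ℕ) • inner ℝ (x - y) (x - y) = 0 := h2
    simp only [real_inner_self_eq_norm_sq, smul_eq_zero, OfNat.ofNat_ne_zero, false_or,
      pow_eq_zero_iff, ne_eq, not_false_eq_true, norm_eq_zero, sub_eq_zero] at h3
    exact hxy h3
  have hpos := gradForm_self_pos hB.self_of_nhds.posDef hψ'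
  -- For `ψ = |q - y|²` and `L` the operator, `L (exp (-αψ)) = α exp (-αψ) (α |∇ψ|² - L ψ)`. As
  -- `∇ψ(x) ≠ 0`, a large `α` makes this positive at `x`, and continuity extends it to a
  -- neighbourhood.
  obtain ⟨α, hα⟩ := exists_gt (max 0 (ellipticOp B ρ ψ x / gradForm B ψ ψ x))
  have hα0 : 0 < α := (le_max_left _ _).trans_lt hα
  have hα1 : ellipticOp B ρ ψ x < α * gradForm B ψ ψ x :=
    (div_lt_iff₀ hpos).1 ((le_max_right _ _).trans_lt hα)
  refine ⟨α, hα0, ?_⟩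
  have hc : ∀ᶠ q in 𝓝 x, ellipticOp B ρ ψ q < α * gradForm B ψ ψ q :=
    (continuousAt_ellipticOp hB.self_of_nhds hψ.contDiffAt).eventually_lt
      (continuousAt_const.mul (continuousAt_gradForm hB.self_of_nhds
        (hψ.contDiffAt.of_le one_le_two) (hψ.contDiffAt.of_le one_le_two))) hα1
  have hd (s : ℝ) : HasDerivAt (fun s => Real.exp (-α * s)) (-α * Real.exp (-α * s)) s := by
    simpa [mul_comm] using ((hasDerivAt_id s).const_mul (-α)).exp
  have hd1 : deriv (fun s => Real.exp (-α * s)) = fun s => -α * Real.exp (-α * s) :=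
    funext fun s => (hd s).deriv
  filter_upwards [hB, hc] with q hq hq'
  have hexp : ContDiff ℝ 2 fun s : ℝ => Real.exp (-α * s) := by fun_prop
  have := ellipticOp_comp hq (h := fun s => Real.exp (-α * s)) hψ.contDiffAt hexp.contDiffAt
  change 0 < ellipticOp B ρ (fun q => Real.exp (-α * ψ q)) q
  rw [this, hd1, ((hd (ψ q)).const_mul (-α)).deriv, smul_eq_mul, smul_eq_mul]
  have : 0 < (α * Real.exp (-α * ψ q)) * (α * gradForm B ψ ψ q - ellipticOp B ρ ψ q) :=
    mul_pos (by positivity) (sub_pos.2 hq')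
  linarith

/-- A subharmonic function cannot have a local maximum at a boundary point `x` of a ball such that
its values on the ball away from `x` are smaller. -/
theorem not_touching_ball {u : EuclideanSpace ℝ (Fin m) → ℝ} {x y : EuclideanSpace ℝ (Fin m)}
    (hxy : x ≠ y) (hB : ∀ᶠ q in 𝓝 x, IsEllipticAt B ρ q) (hu : ∀ᶠ q in 𝓝 x, ContDiffAt ℝ 2 u q)
    (hLu : ∀ᶠ q in 𝓝 x, 0 ≤ ellipticOp B ρ u q) (hmax : IsLocalMax u x)
    (hball : ∀ᶠ q in 𝓝 x, dist q y ≤ dist x y → q ≠ x → u q < u x) : False := by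
  obtain ⟨α, hα, hw⟩ := exists_barrier hxy hB
  obtain ⟨r, hr, hall⟩ := Metric.nhds_basis_closedBall.eventually_iff.1
    (hB.and (hu.and (hLu.and (hmax.and (hball.and hw)))))
  set w : EuclideanSpace ℝ (Fin m) → ℝ := fun q => Real.exp (-α * ‖q - y‖ ^ 2)
  have hwc : ContDiff ℝ 2 w :=
    Real.contDiff_exp.comp (contDiff_const.mul ((contDiff_id.sub contDiff_const).norm_sq ℝ))
  have hucont : ContinuousOn u (Metric.closedBall x r) := fun q hq =>
    (hall hq).2.1.continuousAt.continuousWithinAt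
  have hw1 (q) : w q ≤ 1 := Real.exp_le_one_iff.2 (by nlinarith [sq_nonneg ‖q - y‖])
  have hw0 (q) : 0 < w q := Real.exp_pos _
  -- The perturbation `u + ε w` will be strictly smaller on the small sphere than at `x`. On the
  -- part of the sphere in the ball about `y`, compactness leaves a gap below `u x`; off that ball,
  -- `w q < w x` already suffices.
  obtain ⟨ε, hε, hK⟩ : ∃ ε > 0, ∀ q ∈ Metric.sphere x r ∩ Metric.closedBall y (dist x y),
      u q + ε * w q < u x + ε * w x := by
    rcases (Metric.sphere x r ∩ Metric.closedBall y (dist x y)).eq_empty_or_nonempty with h | h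
    · exact ⟨1, one_pos, by simp [h]⟩
    · obtain ⟨k, hk, hkmax⟩ := ((isCompact_sphere x r).inter_right Metric.isClosed_closedBall)
        |>.exists_isMaxOn h (hucont.mono fun q hq => Metric.sphere_subset_closedBall hq.1)
      have hkx : k ≠ x := fun h => hr.ne' (by simpa [h] using hk.1.symm)
      have hlt : u k < u x := (hall (Metric.sphere_subset_closedBall hk.1)).2.2.2.2.1 hk.2 hkx
      -- With `w ≤ 1`, adding `ε w` on this part raises `u` to at most `u x`, which is below `u x +
      -- ε w x`.
      refine ⟨u x - u k, sub_pos.2 hlt, fun q hq => ?_⟩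
      have h1 : u q ≤ u k := hkmax hq
      nlinarith [hw1 q, hw0 x]
  have hS : ∀ q ∈ Metric.sphere x r, u q + ε * w q < u x + ε * w x := fun q hq => by
    by_cases hqy : dist q y ≤ dist x y
    · exact hK q ⟨hq, hqy⟩
    · have h1 : u q ≤ u x := (hall (Metric.sphere_subset_closedBall hq)).2.2.2.1
      have h2 : w q < w x := by
        refine Real.exp_lt_exp.2 ?_
        have : ‖x - y‖ ^ 2 < ‖q - y‖ ^ 2 := by
          rw [← dist_eq_norm, ← dist_eq_norm]
          exact pow_lt_pow_left₀ (not_le.1 hqy) dist_nonneg two_ne_zero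
        nlinarith
      nlinarith
  obtain ⟨z, hz, hzmax⟩ := (isCompact_closedBall x r).exists_isMaxOn
    ⟨x, Metric.mem_closedBall_self hr.le⟩
    (hucont.add (continuousOn_const.mul hwc.continuous.continuousOn) :
      ContinuousOn (fun q => u q + ε * w q) _)
  have hzx : u x + ε * w x ≤ u z + ε * w z := hzmax (Metric.mem_closedBall_self hr.le)
  have hzb : z ∈ Metric.ball x r := by
    rcases (Metric.mem_closedBall.1 hz).lt_or_eq with h | h
    · exact h
    · exact absurd (hS z h) (not_lt.2 hzx)
  have hloc : IsLocalMax (fun q => u q + ε * w q) z :=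
    hzmax.isLocalMax
    (mem_of_superset (Metric.isOpen_ball.mem_nhds hzb) Metric.ball_subset_closedBall)
  obtain ⟨h1, h2, h3, -, -, h4⟩ := hall hz
  have hwz : ContDiffAt ℝ 2 (fun q => ε * w q) z := (contDiff_const.mul hwc).contDiffAt
  -- At the interior maximum `z` the operator is nonpositive on `u + ε w`, yet it is nonnegative on
  -- `u` and positive on `w`.
  have := ellipticOp_nonpos_of_isLocalMax h1 (h2.add hwz) hloc
  rw [ellipticOp_add h1 h2 hwz] at this
  have h5 : ellipticOp B ρ (fun q => ε * w q) z = ε * ellipticOp B ρ w z :=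
    ellipticOp_clm_comp h1 (ε • ContinuousLinearMap.id ℝ ℝ) hwc.contDiffAt
  rw [h5] at this
  nlinarith [mul_pos hε h4]

/-- The ball with diameter `[0, a]` touches the sphere of radius `‖a‖` about `0` only at `a`: its
inequality reads `‖z‖² ≤ ⟪z, a⟫`, to be combined with `‖z - a‖² > 0`. -/
theorem norm_lt_of_norm_sub_half_le {V : Type*} [NormedAddCommGroup V] [InnerProductSpace ℝ V]
    {z a : V} (h : ‖z - (1 / 2 : ℝ) • a‖ ≤ ‖(1 / 2 : ℝ) • a‖) (hza : z ≠ a) : ‖z‖ < ‖a‖ := by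
  have h1 := pow_le_pow_left₀ (norm_nonneg _) h 2
  rw [norm_sub_sq_real, inner_smul_right] at h1
  have h2 : 0 < ‖z - a‖ ^ 2 := by
    have := norm_pos_iff.2 (sub_ne_zero.2 hza)
    positivity
  rw [norm_sub_sq_real] at h2
  refine lt_of_pow_lt_pow_left₀ 2 (norm_nonneg _) ?_
  linarith

/-- The strong maximum principle, in its local form. -/
theorem eventually_eq_of_isLocalMax {u : EuclideanSpace ℝ (Fin m) → ℝ}
    (hB : ∀ᶠ q in 𝓝 p, IsEllipticAt B ρ q) (hu : ∀ᶠ q in 𝓝 p, ContDiffAt ℝ 2 u q)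
    (hLu : ∀ᶠ q in 𝓝 p, 0 ≤ ellipticOp B ρ u q) (hmax : IsLocalMax u p) :
    ∀ᶠ q in 𝓝 p, u q = u p := by
  obtain ⟨r, hr, hall⟩ := Metric.nhds_basis_ball.eventually_iff.1
    (hB.and (hu.and (hLu.and hmax)))
  -- Points closer to `y₀` than the `x` chosen below are within `δ` of `y₀`, hence within `2δ` of
  -- `p`, where all hypotheses are available.
  obtain ⟨δ, hδ, hδr⟩ : ∃ δ > 0, 2 * δ < r := ⟨r / 3, by positivity, by linarith⟩
  have hsub : Metric.closedBall p (2 * δ) ⊆ Metric.ball p r := Metric.closedBall_subset_ball hδr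
  refine Metric.eventually_nhds_iff_ball.2 ⟨δ, hδ, fun y₀ hy₀ => ?_⟩
  by_contra hne
  let C : Set (EuclideanSpace ℝ (Fin m)) := Metric.closedBall p (2 * δ) ∩ u ⁻¹' {u p}
  have hC : IsCompact C := (isCompact_closedBall p (2 * δ)).of_isClosed_subset
    (ContinuousOn.preimage_isClosed_of_isClosed
      (fun q hq => (hall (hsub hq)).2.1.continuousAt.continuousWithinAt)
      Metric.isClosed_closedBall isClosed_singleton) Set.inter_subset_left
  have hpC : p ∈ C := ⟨Metric.mem_closedBall_self (by positivity), rfl⟩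
  -- A point of the level set `u = u p` nearest to `y₀`: the open ball about `y₀` through `x` misses
  -- the level set.
  obtain ⟨x, hx, hxmin⟩ := hC.exists_isMinOn ⟨p, hpC⟩
    (continuous_id.dist (continuous_const (y := y₀))).continuousOn
  have hxy₀ : dist x y₀ < δ := (show dist x y₀ ≤ dist p y₀ from hxmin hpC).trans_lt
    (by rw [dist_comm]; exact hy₀)
  have hux : u x = u p := hx.2
  have hlt : ∀ q, dist q y₀ < dist x y₀ → u q < u p := fun q hq => by
    have hq' : q ∈ Metric.closedBall p (2 * δ) := by
      rw [Metric.mem_closedBall]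
      have := dist_triangle q y₀ p
      have := Metric.mem_ball.1 hy₀
      linarith
    refine lt_of_le_of_ne (hall (hsub hq')).2.2.2 fun h => ?_
    exact absurd (hxmin ⟨hq', h⟩ : dist x y₀ ≤ dist q y₀) (not_le.2 hq)
  have hxr : x ∈ Metric.ball p r := hsub hx.1
  have hev := eventually_of_mem (Metric.isOpen_ball.mem_nhds hxr) fun q hq => hall hq
  have hxne : x ≠ y₀ := fun h => hne (h ▸ hux)
  -- On the sphere through `x` about `y₀`, `u` may equal `u p` elsewhere too. The ball of half the
  -- radius centred at the midpoint meets that sphere only at `x`.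
  let y : EuclideanSpace ℝ (Fin m) := y₀ + (1 / 2 : ℝ) • (x - y₀)
  have hy : x - y = (1 / 2 : ℝ) • (x - y₀) := by
    simp only [y]
    module
  refine not_touching_ball (u := u) (x := x) (y := y) ?_ (hev.mono fun q h => h.1)
    (hev.mono fun q h => h.2.1) (hev.mono fun q h => h.2.2.1)
    (hev.mono fun q h => h.2.2.2.trans_eq hux.symm) (.of_forall fun q hq hqx => ?_)
  · rw [← sub_ne_zero, hy]
    exact smul_ne_zero (by norm_num) (sub_ne_zero.2 hxne)
  · rw [hux]
    refine hlt q ?_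
    rw [dist_eq_norm, dist_eq_norm]
    refine norm_lt_of_norm_sub_half_le ?_ fun h => hqx (sub_left_injective h)
    rw [dist_eq_norm, dist_eq_norm, hy] at hq
    rwa [show q - y₀ - (1 / 2 : ℝ) • (x - y₀) = q - y by simp only [y]; abel]

end MaximumPrinciple

/-! ### The metric and its Laplacian in charts. -/

theorem contDiffAt_det {E ι : Type*} [NormedAddCommGroup E] [NormedSpace ℝ E] [Fintype ι]
    [DecidableEq ι] {A : E → Matrix ι ι ℝ} {p : E} {n : WithTop ℕ∞}
    (hA : ∀ i j, ContDiffAt ℝ n (fun q => A q i j) p) : ContDiffAt ℝ n (fun q => (A q).det) p := by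
  simp only [Matrix.det_apply]
  exact ContDiffAt.sum fun σ _ => (contDiffAt_prod fun i _ => hA (σ i) i).const_smul _

theorem contDiffAt_matrix_inv {E ι : Type*} [NormedAddCommGroup E] [NormedSpace ℝ E] [Fintype ι]
    [DecidableEq ι] {A : E → Matrix ι ι ℝ} {p : E} {n : WithTop ℕ∞}
    (hA : ∀ i j, ContDiffAt ℝ n (fun q => A q i j) p) (hdet : (A p).det ≠ 0) (i j : ι) :
    ContDiffAt ℝ n (fun q => (A q)⁻¹ i j) p := by
  simp only [Matrix.inv_def, Ring.inverse_eq_inv', Matrix.smul_apply, smul_eq_mul,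
    Matrix.adjugate_apply]
  refine ((contDiffAt_det hA).inv hdet).mul (contDiffAt_det fun k l => ?_)
  by_cases hk : k = j
  · subst hk
    simpa using contDiffAt_const
  · simpa [Matrix.updateRow_apply, hk] using hA k l

section Charts

variable {m : ℕ} {M : Type*} [TopologicalSpace M] [ChartedSpace (EuclideanSpace ℝ (Fin m)) M]
  {e : OpenPartialHomeomorph M (EuclideanSpace ℝ (Fin m))}
  {p : EuclideanSpace ℝ (Fin m)}

theorem contMDiffAt_chart_symm (he : e ∈ IsManifold.maximalAtlas (𝓡 m) ∞ M) (hp : p ∈ e.target) :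
    ContMDiffAt (𝓡 m) (𝓡 m) ∞ e.symm p :=
  contMDiffAt_symm_of_mem_maximalAtlas he hp

theorem mdifferentiable_chart (he : e ∈ IsManifold.maximalAtlas (𝓡 m) ∞ M) :
    e.MDifferentiable (𝓡 m) (𝓡 m) :=
  ⟨(contMDiffOn_of_mem_maximalAtlas he).mdifferentiableOn (by simp),
    (contMDiffOn_symm_of_mem_maximalAtlas he).mdifferentiableOn (by simp)⟩

theorem sum_smul_coordVec (e : OpenPartialHomeomorph M (EuclideanSpace ℝ (Fin m)))
    (p : EuclideanSpace ℝ (Fin m)) (v : Fin m → ℝ) :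
    ∑ i, v i • coordVec e i p = mfderiv (𝓡 m) (𝓡 m) e.symm p
      (WithLp.toLp 2 v : EuclideanSpace ℝ (Fin m)) := by
  have hv : (WithLp.toLp 2 v : EuclideanSpace ℝ (Fin m)) =
      ∑ i, v i • EuclideanSpace.single i (1 : ℝ) := by
    ext k
    simp [Finset.sum_apply, Pi.single_apply]
  rw [hv]
  refine ((map_sum (mfderiv (𝓡 m) (𝓡 m) e.symm p) _ _).trans ?_).symm
  refine Finset.sum_congr rfl fun i _ => ?_
  exact map_smul (mfderiv (𝓡 m) (𝓡 m) e.symm p) _ _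

theorem mdifferentiableAt_chart_symm (he : e ∈ IsManifold.maximalAtlas (𝓡 m) ∞ M)
    (hp : p ∈ e.target) : MDifferentiableAt (𝓡 m) (𝓡 m) e.symm p :=
  (contMDiffAt_chart_symm he hp).mdifferentiableAt (by simp)

theorem mfderiv_chart_symm_bijective (he : e ∈ IsManifold.maximalAtlas (𝓡 m) ∞ M)
    (hp : p ∈ e.target) : Function.Bijective (mfderiv (𝓡 m) (𝓡 m) e.symm p) :=
  (mdifferentiable_chart he).symm.mfderiv_bijective hp

theorem exists_eq_sum_coordVec (he : e ∈ IsManifold.maximalAtlas (𝓡 m) ∞ M) (hp : p ∈ e.target)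
    (v : TangentSpace (𝓡 m) (e.symm p)) : ∃ a : Fin m → ℝ, v = ∑ i, a i • coordVec e i p := by
  obtain ⟨w, rfl⟩ := (mfderiv_chart_symm_bijective he hp).2 v
  exact ⟨(w : EuclideanSpace ℝ (Fin m)).ofLp, (sum_smul_coordVec e p _).symm⟩

variable {F : Type*} [NormedAddCommGroup F] [NormedSpace ℝ F]

theorem contDiffAt_comp_chart_symm (he : e ∈ IsManifold.maximalAtlas (𝓡 m) ∞ M)
    (hp : p ∈ e.target) {φ : M → F} (hφ : ContMDiffAt (𝓡 m) 𝓘(ℝ, F) ∞ φ (e.symm p)) :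
    ContDiffAt ℝ ∞ (φ ∘ e.symm) p :=
  (hφ.comp p (contMDiffAt_chart_symm he hp)).contDiffAt

theorem pd_comp_chart_symm (he : e ∈ IsManifold.maximalAtlas (𝓡 m) ∞ M)
    (hp : p ∈ e.target) {φ : M → F} (hφ : MDifferentiableAt (𝓡 m) 𝓘(ℝ, F) φ (e.symm p))
    (i : Fin m) :
    pd i (φ ∘ e.symm) p = mfderiv (𝓡 m) 𝓘(ℝ, F) φ (e.symm p) (coordVec e i p) := by
  have := mfderiv_comp p hφ (mdifferentiableAt_chart_symm he hp)
  rw [mfderiv_eq_fderiv] at this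
  simp only [pd, this]
  rfl

variable [IsManifold (𝓡 m) ∞ M]

theorem inner_sum_coordVec (g : Metric m M) (a b : Fin m → ℝ) :
    g.inner (e.symm p) (∑ i, a i • coordVec e i p) (∑ i, b i • coordVec e i p) =
      ∑ i, ∑ j, a i * b j * gram g e p i j := by
  simp only [map_sum, map_smul, sum_apply, smul_apply, smul_eq_mul, gram, Matrix.of_apply,
    Finset.mul_sum]
  rw [Finset.sum_comm]
  refine Finset.sum_congr rfl fun i _ => Finset.sum_congr rfl fun j _ => ?_
  ring

theorem gram_posDef (g : Metric m M) (he : e ∈ IsManifold.maximalAtlas (𝓡 m) ∞ M)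
    (hp : p ∈ e.target) : (gram g e p).PosDef := by
  refine Matrix.PosDef.of_dotProduct_mulVec_pos ?_ fun x hx => ?_
  · ext i j
    simp [gram, g.symm]
  · have h0 : ∑ i, x i • coordVec e i p ≠ 0 := by
      rw [sum_smul_coordVec]
      intro h
      have h1 := (mfderiv_chart_symm_bijective he hp).1 (h.trans (map_zero _).symm)
      exact hx (congrArg WithLp.ofLp h1)
    have := g.pos _ _ h0
    rw [inner_sum_coordVec] at this
    simp only [star_trivial, dotProduct, Matrix.mulVec, Finset.mul_sum]
    refine this.trans_eq (Finset.sum_congr rfl fun i _ => Finset.sum_congr rfl fun j _ => ?_)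
    ring

/-- The coordinate fields are images of constant fields under the differential of `e.symm`, hence
smooth along `e.symm`; contracting the smooth metric with them stays smooth. -/
theorem contDiffAt_gram (g : Metric m M) (he : e ∈ IsManifold.maximalAtlas (𝓡 m) ∞ M)
    (hp : p ∈ e.target) (i j : Fin m) : ContDiffAt ℝ ∞ (fun q => gram g e q i j) p := by
  rw [← contMDiffAt_iff_contDiffAt]
  have hcv (i : Fin m) : ContMDiffAt (𝓡 m) ((𝓡 m).prod (𝓡 m)) ∞ (fun q =>
      (Bundle.TotalSpace.mk' (EuclideanSpace ℝ (Fin m)) (e.symm q) (coordVec e i q) :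
        TangentBundle (𝓡 m) M)) p := by
    have hv : ContMDiffAt (𝓡 m) (𝓡 m).tangent ∞
        (fun q : EuclideanSpace ℝ (Fin m) => (Bundle.TotalSpace.mk' (EuclideanSpace ℝ (Fin m)) q
          (EuclideanSpace.single i (1 : ℝ) : EuclideanSpace ℝ (Fin m)) :
          TangentBundle (𝓡 m) (EuclideanSpace ℝ (Fin m)))) p :=
      contMDiffAt_vectorSpace_iff_contDiffAt.2 contDiffAt_const
    exact ContMDiffAt.clm_apply_of_inCoordinates (b₁ := fun q => q)
      ((contMDiffAt_chart_symm he hp).mfderiv_const (m := ∞) le_rfl) hv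
      (contMDiffAt_chart_symm he hp)
  have : ContMDiffAt (𝓡 m) ((𝓡 m).prod 𝓘(ℝ)) ∞
      (fun q ↦ Bundle.TotalSpace.mk' ℝ (E := Bundle.Trivial M ℝ) (e.symm q)
        (g.inner (e.symm q) (coordVec e i q) (coordVec e j q))) p := by
    apply ContMDiffAt.clm_bundle_apply₂ (F₁ := EuclideanSpace ℝ (Fin m))
      (F₂ := EuclideanSpace ℝ (Fin m))
    · exact g.contMDiff.contMDiffAt.comp p (contMDiffAt_chart_symm he hp)
    · exact hcv i
    · exact hcv j
  simp only [Bundle.contMDiffAt_totalSpace] at this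
  exact this.2

theorem isEllipticAt_chart (g : Metric m M) (he : e ∈ IsManifold.maximalAtlas (𝓡 m) ∞ M)
    (hp : p ∈ e.target) :
    IsEllipticAt (fun q => (gram g e q)⁻¹) (fun q => √(gram g e q).det) p where
  posDef := (gram_posDef g he hp).inv
  pos := Real.sqrt_pos.2 (gram_posDef g he hp).det_pos
  contDiffAt_coeff i j := (contDiffAt_matrix_inv (contDiffAt_gram g he hp)
    (gram_posDef g he hp).det_pos.ne' i j).of_le (by simp)
  contDiffAt_density := ((contDiffAt_det (contDiffAt_gram g he hp)).sqrt
    (gram_posDef g he hp).det_pos.ne').of_le (by simp)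

theorem coordLaplacian_eq_ellipticOp (g : Metric m M)
    (e : OpenPartialHomeomorph M (EuclideanSpace ℝ (Fin m))) (φ : M → F) :
    coordLaplacian g e φ = ellipticOp (fun q => (gram g e q)⁻¹) (fun q => √(gram g e q).det)
      (φ ∘ e.symm) :=
  rfl

end Charts

/-! ### Subharmonicity of `|φ|²`. -/

section Subharmonic

variable {m : ℕ} {B : EuclideanSpace ℝ (Fin m) → Matrix (Fin m) (Fin m) ℝ}
  {ρ : EuclideanSpace ℝ (Fin m) → ℝ} {p : EuclideanSpace ℝ (Fin m)}

theorem gradForm_comm (hB : (B p).PosDef) (f h : EuclideanSpace ℝ (Fin m) → ℝ) :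
    gradForm B f h p = gradForm B h f p := by
  rw [gradForm, Finset.sum_comm]
  refine Finset.sum_congr rfl fun i _ => Finset.sum_congr rfl fun j _ => ?_
  have : B p j i = B p i j := by simpa using hB.isHermitian.apply i j
  rw [this]
  ring

/-- The right-hand side is the squared length of `a∇f + b∇h`. -/
theorem gradForm_quadratic_nonneg (hB : (B p).PosDef) (f h : EuclideanSpace ℝ (Fin m) → ℝ)
    (a b : ℝ) :
    0 ≤ a ^ 2 * gradForm B f f p + 2 * a * b * gradForm B f h p + b ^ 2 * gradForm B h h p := by
  have key := hB.posSemidef.dotProduct_mulVec_nonneg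
    (a • (fun i => pd i f p) + b • (fun i => pd i h p))
  have hc := gradForm_comm hB f h
  simp only [gradForm_eq_dotProduct] at hc ⊢
  simp only [star_trivial, Matrix.mulVec_add, Matrix.mulVec_smul, dotProduct_add, add_dotProduct,
    smul_dotProduct, dotProduct_smul, smul_eq_mul] at key
  rw [← hc] at key
  linarith

/-- The complex bilinear form `∑ B_ij ∂_i P ∂_j P`, in real and imaginary parts. -/
theorem sum_pd_mul_pd_eq (hB : (B p).PosDef) {P : EuclideanSpace ℝ (Fin m) → ℂ}
    (hP : DifferentiableAt ℝ P p) :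
    ∑ i, ∑ j, (B p i j : ℂ) * pd i P p * pd j P p =
      ⟨gradForm B (fun q => (P q).re) (fun q => (P q).re) p -
        gradForm B (fun q => (P q).im) (fun q => (P q).im) p,
       2 * gradForm B (fun q => (P q).re) (fun q => (P q).im) p⟩ := by
  have hre (i) : pd i (fun q => (P q).re) p = (pd i P p).re := pd_clm_comp Complex.reCLM hP i
  have him (i) : pd i (fun q => (P q).im) p = (pd i P p).im := pd_clm_comp Complex.imCLM hP i
  apply Complex.ext
  · simp only [Complex.re_sum, gradForm, ← Finset.sum_sub_distrib, hre, him]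
    refine Finset.sum_congr rfl fun i _ => Finset.sum_congr rfl fun j _ => ?_
    simp
  · have hc := gradForm_comm hB (fun q => (P q).re) (fun q => (P q).im)
    rw [two_mul, congrArg (_ + ·) hc]
    simp only [Complex.im_sum, gradForm, ← Finset.sum_add_distrib, hre, him]
    refine Finset.sum_congr rfl fun i _ => Finset.sum_congr rfl fun j _ => ?_
    simp

theorem ellipticOp_sq (hB : IsEllipticAt B ρ p) {u : EuclideanSpace ℝ (Fin m) → ℝ}
    (hu : ContDiffAt ℝ 2 u p) :
    ellipticOp B ρ (fun q => u q ^ 2) p = 2 * u p * ellipticOp B ρ u p + 2 * gradForm B u u p := by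
  have h1 : deriv (fun s : ℝ => s ^ 2) = fun s => 2 * s := by ext s; simp
  have := ellipticOp_comp hB (h := fun s : ℝ => s ^ 2) hu (by fun_prop)
  rw [this, h1]
  simp
  ring

/-- If `L P = lam P` and `∑ B_ij ∂_i P ∂_j P = lam P²` with `lam ≤ 0`, then `|P|²` is
subharmonic. -/
theorem ellipticOp_normSq_nonneg (hB : IsEllipticAt B ρ p) {P : EuclideanSpace ℝ (Fin m) → ℂ}
    (hP : ContDiffAt ℝ 2 P p) {lam : ℝ} (hlam : lam ≤ 0)
    (hL : ellipticOp B ρ P p = lam * P p)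
    (hK : ∑ i, ∑ j, (B p i j : ℂ) * pd i P p * pd j P p = lam * P p ^ 2) :
    0 ≤ ellipticOp B ρ (fun q => Complex.normSq (P q)) p := by
  have hu : ContDiffAt ℝ 2 (fun q => (P q).re) p := Complex.reCLM.contDiff.contDiffAt.comp p hP
  have hv : ContDiffAt ℝ 2 (fun q => (P q).im) p := Complex.imCLM.contDiff.contDiffAt.comp p hP
  have hLu : ellipticOp B ρ (fun q => (P q).re) p = lam * (P p).re := by
    have := ellipticOp_clm_comp hB Complex.reCLM hP
    simpa [hL] using this
  have hLv : ellipticOp B ρ (fun q => (P q).im) p = lam * (P p).im := by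
    have := ellipticOp_clm_comp hB Complex.imCLM hP
    simpa [hL] using this
  rw [sum_pd_mul_pd_eq hB.posDef (hP.differentiableAt (by norm_num))] at hK
  have h1 := congrArg Complex.re hK
  have h2 := congrArg Complex.im hK
  simp [sq] at h1 h2
  have hsplit : (fun q => Complex.normSq (P q)) = fun q => (P q).re ^ 2 + (P q).im ^ 2 := by
    ext q
    rw [Complex.normSq_apply]
    ring
  rw [hsplit, ellipticOp_add hB (hu.pow 2) (hv.pow 2), ellipticOp_sq hB hu, ellipticOp_sq hB hv,
    hLu, hLv]
  have q1 := gradForm_quadratic_nonneg hB.posDef (fun q => (P q).re) (fun q => (P q).im)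
  have q2 := q1 1 0
  have q3 := q1 0 1
  -- The vector here is half the gradient of `|P|²`.
  have q4 := q1 (P p).re (P p).im
  clear q1 hL hK hLu hLv hsplit
  generalize gradForm B (fun q => (P q).re) (fun q => (P q).re) p = a at *
  generalize gradForm B (fun q => (P q).im) (fun q => (P q).im) p = b at *
  generalize gradForm B (fun q => (P q).re) (fun q => (P q).im) p = c at *
  generalize (P p).re = x at *
  generalize (P p).im = y at *
  have hc : c = lam * (x * y) := by linarith
  subst hc
  obtain rfl : b = a - lam * (x * x - y * y) := by linarith
  -- After eliminating `b` and `c`, the quadratic form factors. If `P p ≠ 0`, cancelling `x² + y²`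
  -- leaves `a + lam y² ≥ 0`, half of what is needed; if `P p = 0`, nonnegativity of `a` and `b` is
  -- enough.
  have q5 : 0 ≤ (x ^ 2 + y ^ 2) * (a + lam * y ^ 2) := by nlinarith
  rcases (by positivity : 0 ≤ x ^ 2 + y ^ 2).eq_or_lt with h | h
  · nlinarith [sq_nonneg x, sq_nonneg y]
  · have := nonneg_of_mul_nonneg_right q5 h
    nlinarith

end Subharmonic

/-! ### Constancy of the modulus on a compact connected manifold. -/

section Manifold

variable {m : ℕ} {M : Type*} [TopologicalSpace M] [ChartedSpace (EuclideanSpace ℝ (Fin m)) M]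
  [IsManifold (𝓡 m) ∞ M]

/-- A smooth function with nonnegative Laplacian on a compact connected manifold is constant. -/
theorem eq_of_coordLaplacian_nonneg [CompactSpace M] [ConnectedSpace M] (g : Metric m M)
    {u : M → ℝ} (hu : ContMDiff (𝓡 m) 𝓘(ℝ) ∞ u)
    (hL : ∀ e ∈ IsManifold.maximalAtlas (𝓡 m) ∞ M, ∀ p ∈ e.target, 0 ≤ coordLaplacian g e u p)
    (x y : M) : u x = u y := by
  obtain ⟨z, -, hz⟩ := isCompact_univ.exists_isMaxOn ⟨x, Set.mem_univ x⟩ hu.continuous.continuousOn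
  -- Every point of the maximum set is itself a local maximum, so the local principle makes this
  -- closed set open.
  have hopen : IsOpen {w | u w = u z} := by
    rw [isOpen_iff_mem_nhds]
    intro w hw
    let e := chartAt (EuclideanSpace ℝ (Fin m)) w
    have he : e ∈ IsManifold.maximalAtlas (𝓡 m) ∞ M := IsManifold.chart_mem_maximalAtlas w
    have hwe : w ∈ e.source := mem_chart_source _ w
    have hp : e w ∈ e.target := e.map_source hwe
    have hmem : ∀ᶠ q in 𝓝 (e w), q ∈ e.target := e.open_target.mem_nhds hp
    have key := eventually_eq_of_isLocalMax (u := u ∘ e.symm) (p := e w)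
      (hmem.mono fun q hq => isEllipticAt_chart g he hq)
      (hmem.mono fun q hq => (contDiffAt_comp_chart_symm he hq hu.contMDiffAt).of_le
        ENat.LEInfty.out)
      (hmem.mono fun q hq => hL e he q hq)
      (.of_forall fun q => by
        have h1 : u (e.symm q) ≤ u z := hz (Set.mem_univ _)
        simpa [e.left_inv hwe, show u w = u z from hw] using h1)
    filter_upwards [(e.continuousAt hwe).eventually key, e.open_source.mem_nhds hwe] with v hv hve
    simp only [Function.comp_apply, e.left_inv hve, e.left_inv hwe] at hv
    exact hv.trans hw
  have hclosed : IsClosed {w | u w = u z} := isClosed_eq hu.continuous continuous_const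
  have huniv := IsClopen.eq_univ ⟨hclosed, hopen⟩ ⟨z, rfl⟩
  have h (w : M) : u w = u z := by
    have : w ∈ {w | u w = u z} := huniv ▸ Set.mem_univ w
    exact this
  rw [h x, h y]

theorem IsEigenfunction.norm_eq [CompactSpace M] [ConnectedSpace M] {g : Metric m M} {lam : ℝ}
    (hlam : lam ≤ 0) {φ : M → ℂ} (hφ : IsEigenfunction g (lam : ℂ) (lam : ℂ) φ) (x y : M) :
    ‖φ x‖ = ‖φ y‖ := by
  have hns : ContDiff ℝ ∞ (fun z : ℂ => Complex.normSq z) := by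
    simp only [Complex.normSq_eq_norm_sq]
    exact contDiff_norm_sq ℝ
  have h := eq_of_coordLaplacian_nonneg g (u := fun x => Complex.normSq (φ x))
    (hns.contMDiff.comp hφ.contMDiff) (fun e he p hp => by
      have h1 := hφ.laplacian e he _ (e.map_target hp)
      have h2 := hφ.kappa e he _ (e.map_target hp)
      rw [e.right_inv hp] at h1 h2
      exact ellipticOp_normSq_nonneg (isEllipticAt_chart g he hp)
        ((contDiffAt_comp_chart_symm he hp hφ.contMDiff.contMDiffAt).of_le ENat.LEInfty.out)
        hlam h1 h2)
    x y
  simp only [Complex.normSq_eq_norm_sq] at h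
  exact (sq_eq_sq₀ (norm_nonneg _) (norm_nonneg _)).1 h

end Manifold

/-! ### Local parametrizations of the circle: Frenet-type identities. -/

section CircleChart

variable {f : OpenPartialHomeomorph Circle (EuclideanSpace ℝ (Fin 1))}
  {q : EuclideanSpace ℝ (Fin 1)}

theorem contDiffAt_circle_chart_symm (hf : f ∈ IsManifold.maximalAtlas (𝓡 1) ∞ Circle)
    (hq : q ∈ f.target) : ContDiffAt ℝ ∞ (fun q => (f.symm q : ℂ)) q :=
  contDiffAt_comp_chart_symm hf hq contMDiff_circle_coe.contMDiffAt

theorem pd_circle_chart_symm (hf : f ∈ IsManifold.maximalAtlas (𝓡 1) ∞ Circle)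
    (hq : q ∈ f.target) (i : Fin 1) :
    pd i (fun q => (f.symm q : ℂ)) q = circleIncl (f.symm q) (coordVec f i q) :=
  pd_comp_chart_symm hf hq (contMDiff_circle_coe.mdifferentiableAt (by simp)) i

theorem pd_circle_chart_symm_ne_zero (hf : f ∈ IsManifold.maximalAtlas (𝓡 1) ∞ Circle)
    (hq : q ∈ f.target) : pd 0 (fun q => (f.symm q : ℂ)) q ≠ 0 := by
  rw [pd_circle_chart_symm hf hq]
  intro h
  have h1 := circleIncl_injective _ (h.trans (map_zero _).symm)
  have h2 := (mfderiv_chart_symm_bijective hf hq).1 (h1.trans (map_zero _).symm)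
  have h3 : (EuclideanSpace.single 0 1 : EuclideanSpace ℝ (Fin 1)) = 0 := h2
  simpa using congrFun (congrArg WithLp.ofLp h3) 0

theorem gram_circleMetric {c : ℝ} (hc : 0 < c)
    (hf : f ∈ IsManifold.maximalAtlas (𝓡 1) ∞ Circle) (hq : q ∈ f.target) :
    gram (circleMetric c hc) f q 0 0 =
      c * Complex.normSq (pd 0 (fun q => (f.symm q : ℂ)) q) := by
  rw [pd_circle_chart_symm hf hq, Complex.normSq_eq_norm_sq, ← real_inner_self_eq_norm_sq]
  rfl

theorem pd_normSq {m : ℕ} {P : EuclideanSpace ℝ (Fin m) → ℂ} {p : EuclideanSpace ℝ (Fin m)}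
    (hP : DifferentiableAt ℝ P p) (i : Fin m) :
    pd i (fun q => Complex.normSq (P q)) p =
      2 * ((pd i P p).re * (P p).re + (pd i P p).im * (P p).im) := by
  have hre : DifferentiableAt ℝ (fun q => (P q).re) p :=
    Complex.reCLM.differentiableAt.comp p hP
  have him : DifferentiableAt ℝ (fun q => (P q).im) p :=
    Complex.imCLM.differentiableAt.comp p hP
  have h1 := pd_clm_comp Complex.reCLM hP i
  have h2 := pd_clm_comp Complex.imCLM hP i
  simp only [Complex.reCLM_apply, Complex.imCLM_apply] at h1 h2
  simp only [Complex.normSq_apply]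
  rw [pd_add (hre.fun_mul hre) (him.fun_mul him)]
  have h3 := pd_smul hre hre i
  have h4 := pd_smul him him i
  simp only [smul_eq_mul] at h3 h4
  rw [h3, h4, h1, h2]
  ring

theorem pd_const {m : ℕ} {F : Type*} [NormedAddCommGroup F] [NormedSpace ℝ F] (a : F)
    (p : EuclideanSpace ℝ (Fin m)) (i : Fin m) : pd i (fun _ => a) p = 0 := by
  simp [pd]

theorem circle_chart_symm_orthogonal (hf : f ∈ IsManifold.maximalAtlas (𝓡 1) ∞ Circle)
    (hq : q ∈ f.target) :
    (pd 0 (fun q => (f.symm q : ℂ)) q).re * (f.symm q : ℂ).re +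
      (pd 0 (fun q => (f.symm q : ℂ)) q).im * (f.symm q : ℂ).im = 0 := by
  have h := pd_normSq ((contDiffAt_circle_chart_symm hf hq).differentiableAt (by simp)) 0
  simp only [Circle.normSq_coe, pd_const] at h
  linarith

theorem circle_chart_symm_second_deriv (hf : f ∈ IsManifold.maximalAtlas (𝓡 1) ∞ Circle)
    (hq : q ∈ f.target) :
    (pd 0 (pd 0 (fun q => (f.symm q : ℂ))) q).re * (f.symm q : ℂ).re +
      (pd 0 (pd 0 (fun q => (f.symm q : ℂ))) q).im * (f.symm q : ℂ).im =
      -Complex.normSq (pd 0 (fun q => (f.symm q : ℂ)) q) := by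
  set P : EuclideanSpace ℝ (Fin 1) → ℂ := fun q => (f.symm q : ℂ) with hPdef
  have hP := contDiffAt_circle_chart_symm hf hq
  have hP0 : DifferentiableAt ℝ P q := hP.differentiableAt (by simp)
  have hP1 : DifferentiableAt ℝ (pd 0 P) q := (hP.pd (k := ∞) le_rfl 0).differentiableAt (by simp)
  have hev : (fun q => (pd 0 P q).re * (P q).re + (pd 0 P q).im * (P q).im) =ᶠ[𝓝 q] fun _ => 0 := by
    filter_upwards [f.open_target.mem_nhds hq] with r hr
    exact circle_chart_symm_orthogonal hf hr
  have h0 := (pd_congr hev 0).eq_of_nhds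
  rw [pd_const] at h0
  have r0 : DifferentiableAt ℝ (fun q => (P q).re) q := Complex.reCLM.differentiableAt.comp q hP0
  have i0 : DifferentiableAt ℝ (fun q => (P q).im) q := Complex.imCLM.differentiableAt.comp q hP0
  have r1 : DifferentiableAt ℝ (fun q => (pd 0 P q).re) q :=
    Complex.reCLM.differentiableAt.comp q hP1
  have i1 : DifferentiableAt ℝ (fun q => (pd 0 P q).im) q :=
    Complex.imCLM.differentiableAt.comp q hP1
  have a1 := pd_clm_comp Complex.reCLM hP0 0
  have a2 := pd_clm_comp Complex.imCLM hP0 0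
  have a3 := pd_clm_comp Complex.reCLM hP1 0
  have a4 := pd_clm_comp Complex.imCLM hP1 0
  simp only [Complex.reCLM_apply, Complex.imCLM_apply] at a1 a2 a3 a4
  rw [pd_add (r1.fun_mul r0) (i1.fun_mul i0)] at h0
  have b1 := pd_smul r1 r0 0
  have b2 := pd_smul i1 i0 0
  simp only [smul_eq_mul] at b1 b2
  rw [b1, b2, a1, a2, a3, a4] at h0
  rw [Complex.normSq_apply]
  linarith

/-- For `P = f.symm`, the only metric coefficient is `c |P'|²`, so `Γ` is half its logarithmic
derivative. The constant `c` cancels and `Γ |P'|² = ⟪P'', P'⟫`. -/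
theorem christoffel_circleMetric_mul_normSq {c : ℝ} (hc : 0 < c)
    (hf : f ∈ IsManifold.maximalAtlas (𝓡 1) ∞ Circle) (hq : q ∈ f.target) :
    christoffel (circleMetric c hc) f 0 0 0 q *
        Complex.normSq (pd 0 (fun q => (f.symm q : ℂ)) q) =
      (pd 0 (pd 0 (fun q => (f.symm q : ℂ))) q).re * (pd 0 (fun q => (f.symm q : ℂ)) q).re +
      (pd 0 (pd 0 (fun q => (f.symm q : ℂ))) q).im * (pd 0 (fun q => (f.symm q : ℂ)) q).im := by
  set P : EuclideanSpace ℝ (Fin 1) → ℂ := fun q => (f.symm q : ℂ) with hPdef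
  have hP := contDiffAt_circle_chart_symm hf hq
  have hP1 : DifferentiableAt ℝ (pd 0 P) q := (hP.pd (k := ∞) le_rfl 0).differentiableAt (by simp)
  have hpos : 0 < Complex.normSq (pd 0 P q) :=
    Complex.normSq_pos.2 (pd_circle_chart_symm_ne_zero hf hq)
  have hev : (fun q => gram (circleMetric c hc) f q 0 0) =ᶠ[𝓝 q]
      fun q => c • Complex.normSq (pd 0 P q) := by
    filter_upwards [f.open_target.mem_nhds hq] with r hr
    exact gram_circleMetric hc hf hr
  have hd : pd 0 (fun q => gram (circleMetric c hc) f q 0 0) q =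
      c * (2 * ((pd 0 (pd 0 P) q).re * (pd 0 P q).re + (pd 0 (pd 0 P) q).im * (pd 0 P q).im)) := by
    have hns : ContDiff ℝ 1 (fun z : ℂ => Complex.normSq z) := by
      simp only [Complex.normSq_eq_norm_sq]
      exact contDiff_norm_sq ℝ
    rw [(pd_congr hev 0).eq_of_nhds, pd_smul (differentiableAt_const c)
      ((hns.differentiable (by simp)).differentiableAt.fun_comp' q hP1), pd_normSq hP1, pd_const]
    simp
  have hinv : (gram (circleMetric c hc) f q)⁻¹ 0 0 = (c * Complex.normSq (pd 0 P q))⁻¹ := by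
    rw [← gram_circleMetric hc hf hq]
    simp
  simp only [christoffel, Finset.univ_unique, Fin.default_eq_zero, Finset.sum_singleton, hd, hinv]
  field_simp
  ring

theorem exists_eq_of_orthogonal {D z : ℂ} (h1 : D.re * z.re + D.im * z.im = 0)
    (h2 : z.re * z.re + z.im * z.im = 1) : ∃ a : ℝ, D = ⟨-a * z.im, a * z.re⟩ := by
  -- The coefficient is `⟪D, iz⟫`, the component of `D` along the unit tangent `iz`.
  refine ⟨D.im * z.re - D.re * z.im, Complex.ext ?_ ?_⟩
  · linear_combination (-D.re) * h2 + z.re * h1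
  · linear_combination (-D.im) * h2 + z.im * h1

theorem circle_chart_symm_deriv_sq (hf : f ∈ IsManifold.maximalAtlas (𝓡 1) ∞ Circle)
    (hq : q ∈ f.target) :
    pd 0 (fun q => (f.symm q : ℂ)) q ^ 2 =
      -(Complex.normSq (pd 0 (fun q => (f.symm q : ℂ)) q) : ℂ) * (f.symm q : ℂ) ^ 2 := by
  have h1 := circle_chart_symm_orthogonal hf hq
  have h2 : (f.symm q : ℂ).re * (f.symm q : ℂ).re + (f.symm q : ℂ).im * (f.symm q : ℂ).im = 1 := by
    rw [← Complex.normSq_apply, Circle.normSq_coe]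
  generalize pd 0 (fun q => (f.symm q : ℂ)) q = D at *
  generalize (f.symm q : ℂ) = z at *
  obtain ⟨a, rfl⟩ := exists_eq_of_orthogonal h1 h2
  apply Complex.ext
  · simp [sq, Complex.normSq_apply]
    linear_combination a ^ 2 * (z.re ^ 2 - z.im ^ 2) * h2
  · simp [sq, Complex.normSq_apply]
    linear_combination 2 * a ^ 2 * z.re * z.im * h2

/-- Gauss's formula for the circle in `ℂ`: the tangential part of `P''` is `Γ P'`, and its normal
part is `-|P'|² P`, by differentiating `⟪P', P⟫ = 0`. -/
theorem circle_chart_symm_deriv_deriv {c : ℝ} (hc : 0 < c)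
    (hf : f ∈ IsManifold.maximalAtlas (𝓡 1) ∞ Circle) (hq : q ∈ f.target) :
    pd 0 (pd 0 (fun q => (f.symm q : ℂ))) q =
      christoffel (circleMetric c hc) f 0 0 0 q * pd 0 (fun q => (f.symm q : ℂ)) q -
      Complex.normSq (pd 0 (fun q => (f.symm q : ℂ)) q) * (f.symm q : ℂ) := by
  have h1 := circle_chart_symm_orthogonal hf hq
  have h2 : (f.symm q : ℂ).re * (f.symm q : ℂ).re + (f.symm q : ℂ).im * (f.symm q : ℂ).im = 1 := by
    rw [← Complex.normSq_apply, Circle.normSq_coe]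
  have h3 := circle_chart_symm_second_deriv hf hq
  have h4 := christoffel_circleMetric_mul_normSq hc hf hq
  have h5 := pd_circle_chart_symm_ne_zero hf hq
  generalize pd 0 (pd 0 (fun q => (f.symm q : ℂ))) q = DD at *
  generalize pd 0 (fun q => (f.symm q : ℂ)) q = D at *
  generalize christoffel (circleMetric c hc) f 0 0 0 q = Γ at *
  generalize (f.symm q : ℂ) = z at *
  obtain ⟨a, rfl⟩ := exists_eq_of_orthogonal h1 h2
  have ha : a ≠ 0 := by
    rintro rfl
    exact h5 (Complex.ext (by simp) (by simp))
  simp only [Complex.normSq_apply] at h3 h4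
  have h6 : Γ * a = DD.im * z.re - DD.re * z.im :=
    mul_left_cancel₀ ha (by linear_combination h4 - Γ * a ^ 2 * h2)
  apply Complex.ext
  · simp [Complex.normSq_apply]
    linear_combination (-DD.re) * h2 + z.re * h3 + z.im * h6
  · simp [Complex.normSq_apply]
    linear_combination (-DD.im) * h2 + z.im * h3 - z.re * h6

end CircleChart

/-! ### Laplacian and tension field of circle-valued maps. -/

section CircleValued

variable {m : ℕ} {M : Type*} [TopologicalSpace M] [ChartedSpace (EuclideanSpace ℝ (Fin m)) M]
  [IsManifold (𝓡 m) ∞ M]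

/-- The coordinate expressions of the Laplacian and of `κ` for a map to the circle, in terms of its
tension field. -/
theorem exists_coordLaplacian_circle_eq (g : Metric m M) {c : ℝ} (hc : 0 < c)
    {e : OpenPartialHomeomorph M (EuclideanSpace ℝ (Fin m))}
    (he : e ∈ IsManifold.maximalAtlas (𝓡 m) ∞ M)
    {f : OpenPartialHomeomorph Circle (EuclideanSpace ℝ (Fin 1))}
    (hf : f ∈ IsManifold.maximalAtlas (𝓡 1) ∞ Circle) {π : M → Circle}
    (hπ : ContMDiff (𝓡 m) (𝓡 1) ∞ π) {p : EuclideanSpace ℝ (Fin m)} (hp : p ∈ e.target)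
    (hpf : π (e.symm p) ∈ f.source) :
    ∃ (D : ℂ) (k : ℝ), D ≠ 0 ∧
      coordLaplacian g e (fun x => (π x : ℂ)) p =
        coordTension g (circleMetric c hc) e f π 0 p * D - k * π (e.symm p) ∧
      coordKappa g e (fun x => (π x : ℂ)) (fun x => (π x : ℂ)) p = -k * (π (e.symm p) : ℂ) ^ 2 := by
  let B : EuclideanSpace ℝ (Fin m) → Matrix (Fin m) (Fin m) ℝ := fun q => (gram g e q)⁻¹
  let ρ : EuclideanSpace ℝ (Fin m) → ℝ := fun q => √(gram g e q).det
  let y : EuclideanSpace ℝ (Fin m) → ℝ := fun q => f (π (e.symm q)) 0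
  let ι : EuclideanSpace ℝ (Fin 1) → ℂ := fun q => (f.symm q : ℂ)
  -- Identifies `ℝ` with `ℝ^1`, so that `π` is locally a function of the single real coordinate `y`.
  let l : ℝ → EuclideanSpace ℝ (Fin 1) := fun s => s • EuclideanSpace.single 0 (1 : ℝ)
  have hl (s : ℝ) : HasDerivAt l (EuclideanSpace.single 0 (1 : ℝ)) s := by
    have h := (hasDerivAt_id s).smul_const
        (EuclideanSpace.single 0 (1 : ℝ) : EuclideanSpace ℝ (Fin 1))
    rw [one_smul] at h
    exact h
  have hlq (q : EuclideanSpace ℝ (Fin 1)) : l (q 0) = q := by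
    ext i
    rw [Subsingleton.elim i 0]
    simp [l]
  have hB : IsEllipticAt B ρ p := isEllipticAt_chart g he hp
  have hπe : ContMDiffAt (𝓡 m) (𝓡 1) ∞ (π ∘ e.symm) p :=
    hπ.contMDiffAt.comp p (contMDiffAt_chart_symm he hp)
  have hY : ContDiffAt ℝ ∞ (fun q => f (π (e.symm q))) p :=
    ((contMDiffAt_of_mem_maximalAtlas hf hpf).comp p hπe).contDiffAt
  have hy : ContDiffAt ℝ 2 y p :=
    ((EuclideanSpace.proj (𝕜 := ℝ) (0 : Fin 1)).contDiff.contDiffAt.comp p hY).of_le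
      ENat.LEInfty.out
  have hQ : f (π (e.symm p)) ∈ f.target := f.map_source hpf
  set Q : EuclideanSpace ℝ (Fin 1) := f (π (e.symm p)) with hQdef
  have hlQ : l (y p) = Q := hlq Q
  have hι : ContDiffAt ℝ ∞ ι Q := contDiffAt_circle_chart_symm hf hQ
  have hlc : ContDiff ℝ ∞ l := contDiff_id.smul contDiff_const
  have hh : ContDiffAt ℝ 2 (fun s => ι (l s)) (y p) :=
    (ContDiffAt.comp (y p) (by rw [hlQ]; exact hι) hlc.contDiffAt).of_le ENat.LEInfty.out
  have hd1 : deriv (fun s => ι (l s)) =ᶠ[𝓝 (y p)] fun s => pd 0 ι (l s) := by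
    have : ∀ᶠ s in 𝓝 (y p), l s ∈ f.target := by
      refine hlc.continuous.continuousAt.eventually ?_
      rw [hlQ]
      exact f.open_target.mem_nhds hQ
    filter_upwards [this] with s hs
    exact (((contDiffAt_circle_chart_symm hf hs).differentiableAt
      (by simp)).hasFDerivAt.comp_hasDerivAt s (hl s)).deriv
  have hd2 : deriv (deriv (fun s => ι (l s))) (y p) = pd 0 (pd 0 ι) Q := by
    rw [hd1.deriv_eq]
    have h1 : DifferentiableAt ℝ (pd 0 ι) (l (y p)) := by
      rw [hlQ]
      exact (hι.pd (k := ∞) le_rfl 0).differentiableAt (by simp)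
    refine (h1.hasFDerivAt.comp_hasDerivAt (y p) (hl (y p))).deriv.trans ?_
    rw [hlQ]
    rfl
  have hd1' : deriv (fun s => ι (l s)) (y p) = pd 0 ι Q := by
    rw [hd1.eq_of_nhds, hlQ]
  have hev : ((fun x => (π x : ℂ)) ∘ e.symm) =ᶠ[𝓝 p] fun q => ι (l (y q)) := by
    filter_upwards [hπe.continuousAt.eventually (f.open_source.mem_nhds hpf)] with q hq
    have hq' : π (e.symm q) ∈ f.source := hq
    change (π (e.symm q) : ℂ) = (f.symm (l (f (π (e.symm q)) 0)) : ℂ)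
    rw [hlq, f.left_inv hq']
  have hpd (i) : pd i ((fun x => (π x : ℂ)) ∘ e.symm) p = pd i y p • pd 0 ι Q := by
    rw [(pd_congr hev i).eq_of_nhds, ← hd1']
    exact pd_comp (hy.differentiableAt (by norm_num)) (hh.differentiableAt (by norm_num)) i
  have hιQ : ι Q = (π (e.symm p) : ℂ) := by simp only [ι, hQdef, f.left_inv hpf]
  have hT : coordTension g (circleMetric c hc) e f π 0 p =
      ellipticOp B ρ y p + christoffel (circleMetric c hc) f 0 0 0 Q * gradForm B y y p := by
    simp only [coordTension, Finset.univ_unique, Fin.default_eq_zero, Finset.sum_singleton,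
      gradForm, Finset.mul_sum]
    congr 1
    refine Finset.sum_congr rfl fun i _ => Finset.sum_congr rfl fun j _ => ?_
    simp only [B, y, Q]
    ring
  -- `D` is the velocity of the parametrization and `k` is `|∇y|²` times its squared speed, that is,
  -- `|∇θ|²`.
  refine ⟨pd 0 ι Q, gradForm B y y p * Complex.normSq (pd 0 ι Q),
    pd_circle_chart_symm_ne_zero hf hQ, ?_, ?_⟩
  · rw [coordLaplacian_eq_ellipticOp, ellipticOp_congr hev, ellipticOp_comp hB hy hh, hd1', hd2,
      circle_chart_symm_deriv_deriv hc hf hQ, hT, ← hιQ]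
    simp only [Complex.real_smul]
    push_cast
    ring
  · have hsq : pd 0 ι Q ^ 2 = -(Complex.normSq (pd 0 ι Q) : ℂ) * ι Q ^ 2 :=
      circle_chart_symm_deriv_sq hf hQ
    have : coordKappa g e (fun x => (π x : ℂ)) (fun x => (π x : ℂ)) p =
        (gradForm B y y p : ℂ) * pd 0 ι Q ^ 2 := by
      simp only [coordKappa, hpd, gradForm, Complex.real_smul]
      push_cast
      simp only [Finset.sum_mul]
      refine Finset.sum_congr rfl fun i _ => Finset.sum_congr rfl fun j _ => ?_
      simp only [B]
      ring
    rw [this, hsq, hιQ]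
    push_cast
    ring

end CircleValued

theorem exists_chart_symm_eq {m : ℕ} {M : Type*} [TopologicalSpace M]
    [ChartedSpace (EuclideanSpace ℝ (Fin m)) M] [IsManifold (𝓡 m) ∞ M] (x : M) :
    ∃ e ∈ IsManifold.maximalAtlas (𝓡 m) ∞ M, ∃ p ∈ e.target, e.symm p = x :=
  ⟨chartAt _ x, IsManifold.chart_mem_maximalAtlas x, chartAt _ x x,
    (chartAt _ x).map_source (mem_chart_source _ x), (chartAt _ x).left_inv (mem_chart_source _ x)⟩

/-! ### The angular form `dt` on the circle. -/

section CircleAngle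

/-- The angular component `dt` of a tangent vector of the circle. -/
def circleAngle (z : Circle) : TangentSpace (𝓡 1) z →ₗ[ℝ] ℝ where
  toFun w := (star (z : ℂ) * circleIncl z w).im
  map_add' v w := by rw [map_add, mul_add, Complex.add_im]
  map_smul' a w := by
    rw [map_smul, mul_smul_comm, Complex.smul_im, RingHom.id_apply]

theorem circleIncl_eq (z : Circle) (w : TangentSpace (𝓡 1) z) :
    circleIncl z w = circleAngle z w * (Complex.I * z) := by
  obtain ⟨f, hf, q, hq, rfl⟩ := exists_chart_symm_eq (m := 1) z
  obtain ⟨a, rfl⟩ := exists_eq_sum_coordVec hf hq w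
  have h1 := circle_chart_symm_orthogonal hf hq
  have h2 : (f.symm q : ℂ).re * (f.symm q : ℂ).re + (f.symm q : ℂ).im * (f.symm q : ℂ).im = 1 := by
    rw [← Complex.normSq_apply, Circle.normSq_coe]
  rw [pd_circle_chart_symm hf hq] at h1
  simp only [Finset.univ_unique, Fin.default_eq_zero, Finset.sum_singleton, map_smul]
  have h3 : circleIncl (f.symm q) (coordVec f 0 q) =
      circleAngle (f.symm q) (coordVec f 0 q) * (Complex.I * (f.symm q : ℂ)) := by
    change _ = ((star (f.symm q : ℂ) * circleIncl (f.symm q) (coordVec f 0 q)).im : ℂ) * _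
    generalize circleIncl (f.symm q) (coordVec f 0 q) = D at *
    generalize (f.symm q : ℂ) = z at *
    obtain ⟨b, rfl⟩ := exists_eq_of_orthogonal h1 h2
    apply Complex.ext
    · simp [-mul_eq_mul_right_iff, -mul_eq_mul_left_iff]
      linear_combination (-b) * z.im * h2
    · simp [-mul_eq_mul_right_iff, -mul_eq_mul_left_iff]
      linear_combination (-b) * z.re * h2
  rw [h3]
  simp [mul_assoc]

theorem circleAngle_injective (z : Circle) : Function.Injective (circleAngle z) := fun v w h =>
  circleIncl_injective z (by rw [circleIncl_eq, circleIncl_eq, h])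

theorem circleForm_eq (c : ℝ) (z : Circle) (v w : TangentSpace (𝓡 1) z) :
    circleForm c z v w = c * (circleAngle z v * circleAngle z w) := by
  rw [circleForm_apply, circleIncl_eq, circleIncl_eq, ← Complex.real_smul, ← Complex.real_smul,
    real_inner_smul_left, real_inner_smul_right, real_inner_self_eq_norm_sq, norm_mul,
    Complex.norm_I, Circle.norm_coe]
  ring

end CircleAngle

/-! ### Riemannian submersions onto the circle and `κ`. -/

section Gradient

/-- The vector `n` is the gradient of `η` and spans the complement of `ker η`, so the isometry
condition need only be tested on `n`, where it reads `c (η n)² = η n`. -/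
theorem isometric_on_ker_orthogonal_iff {V : Type*} [AddCommGroup V] [Module ℝ V]
    (B : V →ₗ[ℝ] V →ₗ[ℝ] ℝ) (hpos : ∀ v, v ≠ 0 → 0 < B v v)
    {η : V →ₗ[ℝ] ℝ} (hη : η ≠ 0) {n : V} (hn : ∀ v, B n v = η v) (c : ℝ) :
    (∀ v w, (∀ u, η u = 0 → B v u = 0) → (∀ u, η u = 0 → B w u = 0) →
      c * (η v * η w) = B v w) ↔ c * η n = 1 := by
  have hn0 : n ≠ 0 := by
    rintro rfl
    exact hη (LinearMap.ext fun v => by simp [← hn v])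
  have hnn : 0 < η n := by
    rw [← hn n]
    exact hpos n hn0
  constructor
  · intro h
    have := h n n (fun u hu => by rw [hn, hu]) (fun u hu => by rw [hn, hu])
    rw [hn] at this
    exact mul_right_cancel₀ hnn.ne' (by linarith)
  · intro h
    have key : ∀ v, (∀ u, η u = 0 → B v u = 0) → v = (η v / η n) • n := fun v hv => by
      by_contra hne
      have hd : η (v - (η v / η n) • n) = 0 := by
        rw [map_sub, map_smul, smul_eq_mul, div_mul_cancel₀ _ hnn.ne', sub_self]
      have h2 := hpos _ (sub_ne_zero.2 hne)
      rw [LinearMap.map_sub₂, hv _ hd, LinearMap.map_smul₂, hn, hd] at h2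
      simp at h2
    intro v w hv hw
    nth_rewrite 2 [key v hv]
    rw [map_smul, LinearMap.smul_apply, hn, smul_eq_mul]
    field_simp
    linear_combination (η v * η w) * h

variable {m : ℕ} {M : Type*} [TopologicalSpace M] [ChartedSpace (EuclideanSpace ℝ (Fin m)) M]
  {e : OpenPartialHomeomorph M (EuclideanSpace ℝ (Fin m))}
  {p : EuclideanSpace ℝ (Fin m)}

variable {π : M → Circle}

/-- The pullback `π^* dt` at `x`. -/
def angleForm (π : M → Circle) (x : M) : TangentSpace (𝓡 m) x →ₗ[ℝ] ℝ :=
  circleAngle (π x) ∘ₗ (mfderiv (𝓡 m) (𝓡 1) π x).toLinearMap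

theorem angleForm_eq_zero_iff (x : M) (u : TangentSpace (𝓡 m) x) :
    angleForm π x u = 0 ↔ mfderiv (𝓡 m) (𝓡 1) π x u = 0 :=
  ⟨fun h => circleAngle_injective _ (h.trans (map_zero _).symm), fun h => by
    change circleAngle (π x) (mfderiv (𝓡 m) (𝓡 1) π x u) = 0
    rw [h, map_zero]⟩

theorem mfderiv_surjective_of_angleForm_ne_zero {x : M} (h : angleForm (m := m) π x ≠ 0) :
    Function.Surjective (mfderiv (𝓡 m) (𝓡 1) π x) := by
  obtain ⟨u, hu⟩ : ∃ u, angleForm π x u ≠ 0 := by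
    by_contra! h'
    exact h (LinearMap.ext h')
  intro w
  refine ⟨(circleAngle (π x) w / angleForm π x u) • u, circleAngle_injective _ ?_⟩
  change angleForm π x _ = _
  rw [map_smul, smul_eq_mul, div_mul_cancel₀ _ hu]

variable [IsManifold (𝓡 m) ∞ M]

/-- The gradient is obtained by raising the index of `η` with the inverse Gram matrix. -/
theorem exists_gradient (g : Metric m M) (he : e ∈ IsManifold.maximalAtlas (𝓡 m) ∞ M)
    (hp : p ∈ e.target) (η : TangentSpace (𝓡 m) (e.symm p) →ₗ[ℝ] ℝ) :
    ∃ n, (∀ v, g.inner (e.symm p) n v = η v) ∧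
      η n = ∑ i, ∑ j, (gram g e p)⁻¹ i j * η (coordVec e i p) * η (coordVec e j p) := by
  let a : Fin m → ℝ := fun j => ∑ i, (gram g e p)⁻¹ i j * η (coordVec e i p)
  have hdet : IsUnit (gram g e p).det := (gram_posDef g he hp).det_pos.ne'.isUnit
  refine ⟨∑ j, a j • coordVec e j p, fun v => ?_, ?_⟩
  · obtain ⟨b, rfl⟩ := exists_eq_sum_coordVec he hp v
    rw [inner_sum_coordVec, Finset.sum_comm, map_sum]
    refine Finset.sum_congr rfl fun k _ => ?_
    have h : a = Matrix.vecMul (fun i => η (coordVec e i p)) (gram g e p)⁻¹ := by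
      ext j
      simp only [a, Matrix.vecMul, dotProduct]
      exact Finset.sum_congr rfl fun i _ => mul_comm _ _
    have h2 : Matrix.vecMul a (gram g e p) = fun i => η (coordVec e i p) := by
      rw [h, Matrix.vecMul_vecMul, Matrix.nonsing_inv_mul _ hdet, Matrix.vecMul_one]
    have h3 := congrFun h2 k
    simp only [Matrix.vecMul, dotProduct] at h3
    rw [map_smul, smul_eq_mul, ← h3, Finset.mul_sum]
    exact Finset.sum_congr rfl fun i _ => by ring
  · rw [map_sum, Finset.sum_comm]
    simp only [map_smul, smul_eq_mul, a, Finset.sum_mul]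

theorem coordKappa_circle_eq (g : Metric m M) (he : e ∈ IsManifold.maximalAtlas (𝓡 m) ∞ M)
    (hp : p ∈ e.target) (hπ : ContMDiff (𝓡 m) (𝓡 1) ∞ π) :
    coordKappa g e (fun x => (π x : ℂ)) (fun x => (π x : ℂ)) p =
      -((∑ i, ∑ j, (gram g e p)⁻¹ i j * angleForm π (e.symm p) (coordVec e i p) *
        angleForm π (e.symm p) (coordVec e j p) : ℝ) : ℂ) * (π (e.symm p) : ℂ) ^ 2 := by
  have hpd (i) : pd i ((fun x => (π x : ℂ)) ∘ e.symm) p =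
      angleForm π (e.symm p) (coordVec e i p) * (Complex.I * (π (e.symm p) : ℂ)) := by
    refine (pd_comp_chart_symm he hp
      ((contMDiff_circle_coe.comp hπ).mdifferentiableAt (by simp)) i).trans ?_
    have h := mfderiv_comp (e.symm p) (contMDiff_circle_coe.mdifferentiableAt (by simp))
      (hπ.mdifferentiableAt (x := e.symm p) (by simp))
    refine (congrArg (fun L => L (coordVec e i p)) h).trans ?_
    exact circleIncl_eq _ _
  simp only [coordKappa, hpd]
  push_cast
  simp only [Finset.sum_mul, ← Finset.sum_neg_distrib]
  refine Finset.sum_congr rfl fun i _ => Finset.sum_congr rfl fun j _ => ?_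
  linear_combination ((gram g e p)⁻¹ i j : ℂ) * angleForm π (e.symm p) (coordVec e i p) *
    angleForm π (e.symm p) (coordVec e j p) * (π (e.symm p) : ℂ) ^ 2 * Complex.I_sq

/-- With `η = π^* dt`, both sides say `|η|² = 1 / c`: the left by testing on the gradient of `η`,
the right because `κ(π, π) = -|η|² π²`. -/
theorem submersion_iff_coordKappa (g : Metric m M) (he : e ∈ IsManifold.maximalAtlas (𝓡 m) ∞ M)
    (hp : p ∈ e.target) (hπ : ContMDiff (𝓡 m) (𝓡 1) ∞ π) {c : ℝ} (hc : 0 < c) :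
    (Function.Surjective (mfderiv (𝓡 m) (𝓡 1) π (e.symm p)) ∧
      ∀ (v w : TangentSpace (𝓡 m) (e.symm p)),
      (∀ u, mfderiv (𝓡 m) (𝓡 1) π (e.symm p) u = 0 → g.inner (e.symm p) v u = 0) →
      (∀ u, mfderiv (𝓡 m) (𝓡 1) π (e.symm p) u = 0 → g.inner (e.symm p) w u = 0) →
      (circleMetric c hc).inner (π (e.symm p)) (mfderiv (𝓡 m) (𝓡 1) π (e.symm p) v)
        (mfderiv (𝓡 m) (𝓡 1) π (e.symm p) w) = g.inner (e.symm p) v w) ↔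
    coordKappa g e (fun x => (π x : ℂ)) (fun x => (π x : ℂ)) p =
      ((-1 / c : ℝ) : ℂ) * (π (e.symm p) : ℂ) ^ 2 := by
  obtain ⟨n, hn, hηn⟩ := exists_gradient g he hp (angleForm π (e.symm p))
  have hiff (hη : angleForm π (e.symm p) ≠ 0) := isometric_on_ker_orthogonal_iff
    (V := TangentSpace (𝓡 m) (e.symm p))
    ((ContinuousLinearMap.coeLM ℝ).comp (g.inner (e.symm p)).toLinearMap)
    (g.pos (e.symm p)) hη hn c
  have hκ : coordKappa g e (fun x => (π x : ℂ)) (fun x => (π x : ℂ)) p =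
      ((-1 / c : ℝ) : ℂ) * (π (e.symm p) : ℂ) ^ 2 ↔ c * angleForm π (e.symm p) n = 1 := by
    rw [coordKappa_circle_eq g he hp hπ, ← hηn,
      mul_left_inj' (pow_ne_zero 2 (Circle.coe_ne_zero _)), ← Complex.ofReal_neg,
      Complex.ofReal_inj]
    constructor
    · intro h
      have h' : angleForm π (e.symm p) n = 1 / c := by linarith [neg_div c 1]
      rw [h']
      field_simp
    · intro h
      field_simp
      linarith
  rw [hκ]
  simp only [← angleForm_eq_zero_iff]
  have hinner (v w) : (circleMetric c hc).inner (π (e.symm p))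
      (mfderiv (𝓡 m) (𝓡 1) π (e.symm p) v) (mfderiv (𝓡 m) (𝓡 1) π (e.symm p) w) =
      c * (angleForm π (e.symm p) v * angleForm π (e.symm p) w) := circleForm_eq c _ _ _
  simp only [hinner]
  constructor
  · rintro ⟨h1, h2⟩
    refine (hiff fun h0 => ?_).1 h2
    obtain ⟨u, hu⟩ := h1 (EuclideanSpace.single 0 (1 : ℝ) : EuclideanSpace ℝ (Fin 1))
    have h3 := (angleForm_eq_zero_iff (π := π) (e.symm p) u).1 (by rw [h0]; rfl)
    have h4 : (EuclideanSpace.single 0 1 : EuclideanSpace ℝ (Fin 1)) = 0 := hu.symm.trans h3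
    simpa using congrFun (congrArg WithLp.ofLp h4) 0
  · intro h
    have hη : angleForm π (e.symm p) ≠ 0 := fun h0 => by
      rw [h0, LinearMap.zero_apply, mul_zero] at h
      exact zero_ne_one h
    exact ⟨mfderiv_surjective_of_angleForm_ne_zero hη, (hiff hη).2 h⟩

end Gradient

/-! ### From eigenfunctions to harmonic Riemannian submersions and back. -/

section Eigenfunctions

variable {m : ℕ} {M : Type*} [TopologicalSpace M] [ChartedSpace (EuclideanSpace ℝ (Fin m)) M]
  [IsManifold (𝓡 m) ∞ M] {g : Metric m M}

theorem IsEigenfunction.const_mul {lam mu : ℂ} {φ : M → ℂ} (hφ : IsEigenfunction g lam mu φ)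
    (a : ℂ) : IsEigenfunction g lam mu (fun x => a * φ x) where
  contMDiff := (ContinuousLinearMap.mul ℝ ℂ a).contDiff.contMDiff.comp hφ.contMDiff
  laplacian e he x hx := by
    have hp := e.map_source hx
    have := ellipticOp_clm_comp (isEllipticAt_chart g he hp) (ContinuousLinearMap.mul ℝ ℂ a)
      ((contDiffAt_comp_chart_symm he hp hφ.contMDiff.contMDiffAt).of_le ENat.LEInfty.out)
    refine this.trans ?_
    rw [← coordLaplacian_eq_ellipticOp, hφ.laplacian e he x hx]
    simp only [ContinuousLinearMap.mul_apply']
    ring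
  kappa e he x hx := by
    have hp := e.map_source hx
    have hpd (i) : pd i ((fun x => a * φ x) ∘ e.symm) (e x) = a * pd i (φ ∘ e.symm) (e x) :=
      pd_clm_comp (ContinuousLinearMap.mul ℝ ℂ a)
        ((contDiffAt_comp_chart_symm he hp hφ.contMDiff.contMDiffAt).differentiableAt (by simp)) i
    have h : coordKappa g e (fun x => a * φ x) (fun x => a * φ x) (e x) =
        a ^ 2 * coordKappa g e φ φ (e x) := by
      simp only [coordKappa, hpd, Finset.mul_sum]
      refine Finset.sum_congr rfl fun i _ => Finset.sum_congr rfl fun j _ => ?_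
      ring
    rw [h, hφ.kappa e he x hx]
    ring

/-- A map to the circle with `κ(π, π) = mu π²`, `mu ≠ 0`, on a compact manifold is onto: otherwise
its argument has a maximum, where `κ(π, π)` vanishes. -/
theorem surjective_of_hasKappa [CompactSpace M] [Nonempty M] {π : M → Circle} {mu : ℂ}
    (hmu : mu ≠ 0) (hπ : ContMDiff (𝓡 m) (𝓡 1) ∞ π)
    (hκ : HasKappa g (fun x => (π x : ℂ)) (fun x => (π x : ℂ)) (fun x => mu * (π x : ℂ) ^ 2)) :
    Function.Surjective π := by
  intro z
  by_contra! hz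
  -- This rotation sends the omitted value `z` to `-1`, so `a * π` avoids the branch cut of the
  -- logarithm.
  let a : ℂ := -(z : ℂ)⁻¹
  have ha : a ≠ 0 := neg_ne_zero.2 (inv_ne_zero (Circle.coe_ne_zero z))
  have hna : ‖a‖ = 1 := by
    rw [norm_neg, norm_inv, Circle.norm_coe, inv_one]
  have hslit : ∀ x, a * π x ∈ Complex.slitPlane := fun x => by
    rw [Complex.mem_slitPlane_iff_arg]
    refine ⟨fun harg => hz x ?_, mul_ne_zero ha (Circle.coe_ne_zero _)⟩
    have h1 := Complex.norm_mul_exp_arg_mul_I (a * π x)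
    rw [harg, Complex.exp_pi_mul_I, norm_mul, hna, Circle.norm_coe] at h1
    have h2 : (z : ℂ)⁻¹ * π x = 1 := by
      simp only [a] at h1
      push_cast at h1
      linear_combination h1
    exact Circle.ext ((inv_mul_eq_one₀ (Circle.coe_ne_zero z)).1 h2).symm
  have hsm : ContMDiff (𝓡 m) 𝓘(ℝ, ℂ) ∞ (fun x => a * (π x : ℂ)) :=
    (ContinuousLinearMap.mul ℝ ℂ a).contDiff.contMDiff.comp (contMDiff_circle_coe.comp hπ)
  have hcont : Continuous fun x => (Complex.log (a * π x)).im :=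
    Complex.continuous_im.comp (hsm.continuous.clog hslit)
  obtain ⟨x, -, hx⟩ := isCompact_univ.exists_isMaxOn Set.univ_nonempty hcont.continuousOn
  obtain ⟨e, he, p, hp, rfl⟩ := exists_chart_symm_eq (m := m) x
  let P : EuclideanSpace ℝ (Fin m) → ℂ := (fun x => a * (π x : ℂ)) ∘ e.symm
  have hP : DifferentiableAt ℝ P p :=
    (contDiffAt_comp_chart_symm he hp hsm.contMDiffAt).differentiableAt (by simp)
  have hπd : DifferentiableAt ℝ ((fun x => (π x : ℂ)) ∘ e.symm) p :=
    (contDiffAt_comp_chart_symm he hp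
      (contMDiff_circle_coe.comp hπ).contMDiffAt).differentiableAt (by simp)
  have hlog := ((Complex.hasStrictDerivAt_log
    (hslit (e.symm p))).hasDerivAt.hasFDerivAt.restrictScalars ℝ).comp p hP.hasFDerivAt
  have hre : (fun q => (Complex.log (P q)).re) = fun _ => (0 : ℝ) := by
    ext q
    have h1 : ‖P q‖ = 1 := by
      change ‖a * (π (e.symm q) : ℂ)‖ = 1
      rw [norm_mul, hna, Circle.norm_coe, mul_one]
    rw [Complex.log_re, h1, Real.log_one]
  have him : IsLocalMax (fun q => (Complex.log (P q)).im) p := .of_forall fun q => hx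
    (Set.mem_univ _)
  -- The real part of the logarithm is `0` since `|a π| = 1`, and its imaginary part is critical at
  -- the maximum; hence the logarithm, and with it `π`, has zero differential there.
  have hre' := (Complex.reCLM.hasFDerivAt.comp p hlog).fderiv
  have him' := (Complex.imCLM.hasFDerivAt.comp p hlog).fderiv.symm.trans him.fderiv_eq_zero
  have hre'' := hre'.symm.trans ((congrArg (fun F => fderiv ℝ F p) hre).trans
    (fderiv_const_apply (0 : ℝ)))
  have hpd (i) : pd i ((fun x => (π x : ℂ)) ∘ e.symm) p = 0 := by
    have h1 : pd i P p = a * pd i ((fun x => (π x : ℂ)) ∘ e.symm) p :=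
      pd_clm_comp (ContinuousLinearMap.mul ℝ ℂ a) hπd i
    have h2 : pd i P p * (P p)⁻¹ = 0 := Complex.ext
      (congrArg (fun L : EuclideanSpace ℝ (Fin m) →L[ℝ] ℝ => L (EuclideanSpace.single i 1)) hre'')
      (congrArg (fun L : EuclideanSpace ℝ (Fin m) →L[ℝ] ℝ => L (EuclideanSpace.single i 1)) him')
    have h3 : P p ≠ 0 := mul_ne_zero ha (Circle.coe_ne_zero _)
    rw [h1] at h2
    simpa [h3, ha] using h2
  have h := hκ e he _ (e.map_target hp)
  rw [e.right_inv hp] at h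
  simp only [coordKappa, hpd, mul_zero, Finset.sum_const_zero] at h
  exact mul_ne_zero hmu (pow_ne_zero 2 (Circle.coe_ne_zero _)) h.symm

theorem neg_one_div_one_div_abs {lam : ℝ} (hlam : lam < 0) : -1 / (1 / |lam|) = lam := by
  rw [abs_of_neg hlam]
  field_simp

/-- The κ-equation forces `k = -lam`, so the Laplace equation leaves `τ(π) D = 0` with `D ≠ 0`. Any
`c > 0` works, since constant rescaling of the target preserves harmonicity. -/
theorem IsEigenfunction.isHarmonicMap {π : M → Circle} {lam : ℝ} {c : ℝ} (hc : 0 < c)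
    (hπ : ContMDiff (𝓡 m) (𝓡 1) ∞ π)
    (h : IsEigenfunction g (lam : ℂ) (lam : ℂ) (fun x => (π x : ℂ))) :
    IsHarmonicMap g (circleMetric c hc) π where
  contMDiff := hπ
  tension_eq_zero e he f hf x hx hxf γ := by
    have hp := e.map_source hx
    rw [Subsingleton.elim γ 0]
    obtain ⟨D, k, hD, h1, h2⟩ := exists_coordLaplacian_circle_eq g hc he hf hπ hp
      (by rwa [e.left_inv hx])
    rw [h.kappa e he x hx, e.left_inv hx] at h2
    rw [h.laplacian e he x hx, e.left_inv hx] at h1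
    have hk := mul_right_cancel₀ (pow_ne_zero 2 (Circle.coe_ne_zero (π x))) h2
    rw [hk] at h1
    have h3 : (coordTension g (circleMetric c hc) e f π 0 (e x) : ℂ) * D = 0 := by
      linear_combination -h1
    exact_mod_cast (mul_eq_zero.1 h3).resolve_right hD

theorem IsEigenfunction.isRiemannianSubmersion [CompactSpace M] [Nonempty M] {π : M → Circle}
    {lam : ℝ} (hlam : lam < 0) (hc : 0 < 1 / |lam|) (hπ : ContMDiff (𝓡 m) (𝓡 1) ∞ π)
    (h : IsEigenfunction g (lam : ℂ) (lam : ℂ) (fun x => (π x : ℂ))) :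
    IsRiemannianSubmersion g (circleMetric (1 / |lam|) hc) π := by
  have key {e} (he : e ∈ IsManifold.maximalAtlas (𝓡 m) ∞ M) {p} (hp : p ∈ e.target) :=
    (submersion_iff_coordKappa g he hp hπ hc).2 (by
      have h2 := h.kappa e he _ (e.map_target hp)
      rwa [e.right_inv hp, ← congrArg Complex.ofReal (neg_one_div_one_div_abs hlam)] at h2)
  refine ⟨hπ, surjective_of_hasKappa (by exact_mod_cast hlam.ne) hπ h.kappa, fun x => ?_,
    fun x => ?_⟩
  all_goals
    obtain ⟨e, he, p, hp, rfl⟩ := exists_chart_symm_eq (m := m) x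
  exacts [(key he hp).1, (key he hp).2]

theorem IsRiemannianSubmersion.isEigenfunction {π : M → Circle} {lam : ℝ} (hlam : lam < 0)
    (hc : 0 < 1 / |lam|) (hs : IsRiemannianSubmersion g (circleMetric (1 / |lam|) hc) π)
    (hh : IsHarmonicMap g (circleMetric (1 / |lam|) hc) π) :
    IsEigenfunction g (lam : ℂ) (lam : ℂ) (fun x => (π x : ℂ)) := by
  have hκ (e) (he : e ∈ IsManifold.maximalAtlas (𝓡 m) ∞ M) (x) (hx : x ∈ e.source) :
      coordKappa g e (fun x => (π x : ℂ)) (fun x => (π x : ℂ)) (e x) = lam * (π x : ℂ) ^ 2 := by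
    have h1 := (submersion_iff_coordKappa g he (e.map_source hx) hs.contMDiff hc).1
      ⟨hs.surjective_mfderiv _, hs.isometric _⟩
    rwa [neg_one_div_one_div_abs hlam, e.left_inv hx] at h1
  refine ⟨contMDiff_circle_coe.comp hs.contMDiff, fun e he x hx => ?_, hκ⟩
  obtain ⟨f, hf, q, hq, hqx⟩ := exists_chart_symm_eq (m := 1) (π x)
  have hxf : π x ∈ f.source := hqx ▸ f.map_target hq
  obtain ⟨D, k, hD, h1, h2⟩ := exists_coordLaplacian_circle_eq g hc he hf hs.contMDiff
    (e.map_source hx) (by rwa [e.left_inv hx])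
  rw [hκ e he x hx, e.left_inv hx] at h2
  rw [hh.tension_eq_zero e he f hf x hx hxf 0, e.left_inv hx] at h1
  have hk := mul_right_cancel₀ (pow_ne_zero 2 (Circle.coe_ne_zero (π x))) h2
  rw [h1, hk]
  push_cast
  ring

theorem contMDiff_circle_of_coe {π : M → Circle}
    (hπ : ContMDiff (𝓡 m) 𝓘(ℝ, ℂ) ∞ (fun x => (π x : ℂ))) : ContMDiff (𝓡 m) (𝓡 1) ∞ π :=
  haveI : Fact (Module.finrank ℝ ℂ = 1 + 1) := finrank_real_complex_fact'
  ContMDiff.codRestrict_sphere (n := 1) hπ fun x => (π x).2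

end Eigenfunctions

end LLEigen

end

theorem theorem1p1 {m : ℕ} {M : Type*} [TopologicalSpace M] [T2Space M] [CompactSpace M]
    [ConnectedSpace M] [ChartedSpace (EuclideanSpace ℝ (Fin m)) M] [IsManifold (𝓡 m) ∞ M]
    (g : LLEigen.Metric m M) (lam : ℝ) (hlam : lam < 0) (φ : M → ℂ)
    (hφ : ContMDiff (𝓡 m) 𝓘(ℝ, ℂ) ∞ φ) (hconst : ¬ ∃ c, ∀ x, φ x = c) :
    LLEigen.IsEigenfunction g (lam : ℂ) (lam : ℂ) φ ↔
      ∀ x₀ : M, φ x₀ ≠ 0 ∧ ∃ π : M → Circle,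
        (∀ x, (π x : ℂ) = φ x / (‖φ x₀‖ : ℂ)) ∧
        LLEigen.IsHarmonicMap g
          (LLEigen.circleMetric (1 / |lam|) (one_div_pos.2 (abs_pos.2 hlam.ne))) π ∧
        LLEigen.IsRiemannianSubmersion g
          (LLEigen.circleMetric (1 / |lam|) (one_div_pos.2 (abs_pos.2 hlam.ne))) π := by
  constructor
  · intro h x₀
    have hnorm := h.norm_eq hlam.le
    -- Constant modulus would spread a single zero to all of `M`.
    have h0 : φ x₀ ≠ 0 := fun h0 => hconst
      ⟨0, fun x => norm_eq_zero.1 (by rw [hnorm x x₀, h0, norm_zero])⟩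
    have hr : ‖φ x₀‖ ≠ 0 := norm_ne_zero_iff.2 h0
    let π : M → Circle := fun x => ⟨φ x / (‖φ x₀‖ : ℂ), by
      refine mem_sphere_zero_iff_norm.2 ?_
      rw [norm_div, hnorm x x₀]
      simp [hr]⟩
    have hπφ : (fun x => (π x : ℂ)) = fun x => (‖φ x₀‖ : ℂ)⁻¹ * φ x := by
      ext x
      exact div_eq_inv_mul _ _
    have hπ : LLEigen.IsEigenfunction g (lam : ℂ) (lam : ℂ) (fun x => (π x : ℂ)) := by
      rw [hπφ]
      exact h.const_mul _
    have hsm := LLEigen.contMDiff_circle_of_coe hπ.contMDiff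
    exact ⟨h0, π, fun x => rfl, hπ.isHarmonicMap _ hsm, hπ.isRiemannianSubmersion hlam _ hsm⟩
  · intro h
    -- A single base point suffices for the converse.
    obtain ⟨x₀⟩ := (inferInstance : Nonempty M)
    obtain ⟨h0, π, hπ, hharm, hsub⟩ := h x₀
    have hr : (‖φ x₀‖ : ℂ) ≠ 0 := by exact_mod_cast norm_ne_zero_iff.2 h0
    have hφπ : φ = fun x => (‖φ x₀‖ : ℂ) * π x := by
      ext x
      rw [hπ, mul_div_cancel₀ _ hr]
    rw [hφπ]
    exact (hsub.isEigenfunction hlam _ hharm).const_mul _
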